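/- Let $d \ge 3$ be an odd integer, let $X = \{1, \ldots, d\}$, and let $T$ be the $d$-regular rooted tree whose vertices are the finite words over $X$, with the empty word as root, the children of $u$ being the words $ux$, $x \in X$. Let $G_d \le \mathrm{Aut}(T)$ be the group generated by $a_1, \ldots, a_d$, where, with indices read modulo $d$, $a_i$ exchanges the letters $i$ and $i+1$ in first position, and its sections are $a_i$ at $i$, $a_{i+1}$ at $i+1$ and the identity at every other letter; that is, for every word $v$, $$a_i(i\,v) = (i+1)\,a_i(v), \qquad a_i((i+1)\,v) = i\,a_{i+1}(v), \qquad a_i(x\,v) = x\,v \quad (x \ne i, i+1).$$ For $k \ge 1$ let $\mathrm{St}(k)$ be the subgroup of the elements of $G_d$ that fix all vertices of level $k$, and let $\mathrm{Rist}(k)$ be the subgroup generated by the rigid stabilizers of the vertices of level $k$, the rigid stabilizer of a vertex $u$ being the group of the elements of $G_d$ that fix every vertex outside the subtree rooted at $u$. Put $\widetilde{G}_d = \varprojlim_{k \ge 1} G_d/\mathrm{Rist}(k)$ and $\overline{G}_d = \varprojlim_{k \ge 1} G_d/\mathrm{St}(k)$. Then the rigid kernel $\ker(\widetilde{G}_d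 \to \overline{G}_d)$, which is canonically the inverse limit $\varprojlim_{k \ge 1} \mathrm{St}(k)/\mathrm{Rist}(k)$, is isomorphic, as a group, to the abelian group $$\prod_{k \ge 1} \left(\mathbb{Z}/2^k\mathbb{Z}\right)^{d^k - d^{k-1}}.$$ Moreover, $G_d$ does not have the congruence subgroup property: there is a subgroup of finite index in $G_d$ that contains no level stabilizer. -/

import Mathlib

/-- Vertices of the `d`-regular rooted tree: finite words over the alphabet `X`. The letters are
labelled by the residues modulo `d`, so that the cyclic successor of the letter `i` is `i + 1`. -/
abbrev Vertex (d : ℕ) : Type := List (ZMod d)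

/-- The `d`-regular rooted tree (for `d ≥ 1`): the vertex `u` is joined to its children `ux`,
where `x` runs through the letters; the root is the empty word. -/
def regularTree (d : ℕ) : SimpleGraph (Vertex d) where
  Adj u v := (∃ x, v = u ++ [x]) ∨ (∃ x, u = v ++ [x])
  symm := ⟨fun _ _ h => h.symm⟩
  loopless := ⟨fun u h => by simp at h⟩

/-- `Aut(T)`: the group of graph automorphisms of the rooted tree that fix the root. -/
abbrev TreeAut (d : ℕ) : Subgroup (regularTree d ≃g regularTree d) :=
  MulAction.stabilizer (regularTree d ≃g regularTree d) ([] : Vertex d)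

/-! ### Root-preserving automorphisms preserve levels and prefixes -/

theorem TreeAut.exists_append {d : ℕ} (g : TreeAut d) (u : Vertex d) (x : ZMod d) :
    ∃ y, g • (u ++ [x]) = g • u ++ [y] := by
  induction u using List.reverseRecOn generalizing x with
  | nil =>
    have h : (regularTree d).Adj (g.1 []) (g.1 ([] ++ [x])) :=
      g.1.map_rel_iff.2 (Or.inl ⟨x, rfl⟩)
    have hr : g.1 [] = [] := g.2
    rcases h with ⟨y, hy⟩ | ⟨y, hy⟩
    · exact ⟨y, hy⟩
    · rw [hr] at hy
      simp at hy
  | append_singleton u z ih =>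
    have h : (regularTree d).Adj (g.1 (u ++ [z])) (g.1 (u ++ [z] ++ [x])) :=
      g.1.map_rel_iff.2 (Or.inl ⟨x, rfl⟩)
    rcases h with ⟨y, hy⟩ | ⟨y, hy⟩
    · exact ⟨y, hy⟩
    · obtain ⟨z', hz'⟩ := ih z
      have h1 : g.1 (u ++ [z]) = g.1 u ++ [z'] := hz'
      rw [h1] at hy
      have h2 : g.1 u = g.1 (u ++ [z] ++ [x]) := (List.append_inj' hy rfl).1
      have h3 := congrArg List.length (g.1.injective h2)
      simp at h3

theorem TreeAut.length_smul {d : ℕ} (g : TreeAut d) (u : Vertex d) :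
    (g • u).length = u.length := by
  induction u using List.reverseRecOn with
  | nil =>
    have hr : g • ([] : Vertex d) = [] := g.2
    rw [hr]
  | append_singleton u z ih =>
    obtain ⟨y, hy⟩ := TreeAut.exists_append g u z
    rw [hy]
    simp [ih]

theorem TreeAut.prefix_smul {d : ℕ} (g : TreeAut d) {u w : Vertex d} (h : u <+: w) :
    g • u <+: g • w := by
  obtain ⟨v, rfl⟩ := h
  induction v using List.reverseRecOn with
  | nil => simp
  | append_singleton v z ih =>
    obtain ⟨y, hy⟩ := TreeAut.exists_append g (u ++ v) z
    rw [← List.append_assoc, hy]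
    exact ih.trans (List.prefix_append _ _)

/-! ### Level stabilizers and rigid stabilizers of a group of tree automorphisms -/

/-- The `k`-th level stabilizer of `G`: the elements of `G` that fix every vertex of level `k`. -/
def levelStab {d : ℕ} (G : Subgroup (TreeAut d)) (k : ℕ) : Subgroup G :=
  fixingSubgroup G {u : Vertex d | u.length = k}

/-- The rigid stabilizer of the vertex `u` in `G`: the elements of `G` that fix every vertex
outside the subtree rooted at `u`. -/
def vertexRist {d : ℕ} (G : Subgroup (TreeAut d)) (u : Vertex d) : Subgroup G :=
  fixingSubgroup G {w : Vertex d | ¬ u <+: w}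

/-- The `k`-th level rigid stabilizer of `G`: the subgroup generated by the rigid stabilizers of
the vertices of level `k`. -/
def levelRist {d : ℕ} (G : Subgroup (TreeAut d)) (k : ℕ) : Subgroup G :=
  ⨆ u : {u : Vertex d // u.length = k}, vertexRist G u.1

section Helpers

variable {d : ℕ} (G : Subgroup (TreeAut d))

theorem mem_levelStab {k : ℕ} {g : G} :
    g ∈ levelStab G k ↔ ∀ u : Vertex d, u.length = k → g • u = u :=
  mem_fixingSubgroup_iff G

theorem mem_vertexRist {u : Vertex d} {g : G} :
    g ∈ vertexRist G u ↔ ∀ w : Vertex d, ¬ u <+: w → g • w = w :=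
  mem_fixingSubgroup_iff G

theorem length_smul_vertex (g : G) (u : Vertex d) : (g • u).length = u.length :=
  TreeAut.length_smul g.1 u

theorem prefix_smul_vertex (g : G) {u w : Vertex d} (h : u <+: w) : g • u <+: g • w :=
  TreeAut.prefix_smul g.1 h

instance levelStab_normal (k : ℕ) : (levelStab G k).Normal := by
  refine ⟨fun n hn g => ?_⟩
  rw [mem_levelStab] at hn ⊢
  intro u hu
  rw [mul_smul, mul_smul, hn (g⁻¹ • u) (by rw [length_smul_vertex, hu]), smul_inv_smul]

theorem conj_mem_vertexRist (g n : G) {u : Vertex d} (hn : n ∈ vertexRist G u) :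
    g * n * g⁻¹ ∈ vertexRist G (g • u) := by
  rw [mem_vertexRist] at hn ⊢
  intro w hw
  rw [mul_smul, mul_smul, hn (g⁻¹ • w), smul_inv_smul]
  intro h
  apply hw
  have := prefix_smul_vertex G g h
  rwa [smul_inv_smul] at this

instance levelRist_normal (k : ℕ) : (levelRist G k).Normal := by
  refine ⟨fun n hn g => ?_⟩
  have h : levelRist G k ≤ (levelRist G k).comap (MulAut.conj g).toMonoidHom := by
    refine iSup_le fun u m hm => ?_
    have h1 : g * m * g⁻¹ ∈ vertexRist G (g • u.1) := conj_mem_vertexRist G g m hm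
    exact (le_iSup (fun v : {v : Vertex d // v.length = k} => vertexRist G v.1)
      ⟨g • u.1, by rw [length_smul_vertex, u.2]⟩) h1
  exact h hn

theorem levelStab_antitone : Antitone (levelStab G) := by
  intro k l hkl g hg
  rw [mem_levelStab] at hg ⊢
  intro u hu
  let v : Vertex d := List.replicate (l - k) 0
  have h1 : g • (u ++ v) = u ++ v := hg _ (by simp [v, hu]; omega)
  have h2 : g • u <+: u ++ v := by
    have := prefix_smul_vertex G g (List.prefix_append u v)
    rwa [h1] at this
  obtain ⟨t, ht⟩ := h2
  exact (List.append_inj ht (length_smul_vertex G g u)).1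

theorem levelRist_antitone : Antitone (levelRist G) := by
  intro k l hkl
  refine iSup_le fun u m hm => ?_
  have h1 : m ∈ vertexRist G (u.1.take k) := by
    rw [mem_vertexRist] at hm ⊢
    intro w hw
    exact hm w fun h => hw ((List.take_prefix k u.1).trans h)
  exact (le_iSup (fun v : {v : Vertex d // v.length = k} => vertexRist G v.1)
    ⟨u.1.take k, by simp [u.2, hkl]⟩) h1

theorem levelRist_le_levelStab (k : ℕ) : levelRist G k ≤ levelStab G k := by
  refine iSup_le fun u m hm => ?_
  rw [mem_vertexRist] at hm
  rw [mem_levelStab]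
  have key : ∀ w : Vertex d, w.length = k → w ≠ u.1 → m • w = w := fun w hw hne =>
    hm w fun h => hne (h.eq_of_length (by rw [u.2, hw])).symm
  intro w hw
  by_cases h : m • w = u.1
  · by_cases hwu : w = u.1
    · rw [h, hwu]
    · exact key w hw hwu
  · exact smul_left_cancel m (key (m • w) (by rw [length_smul_vertex, hw]) h)

end Helpers

/-! ### Completions and the rigid kernel -/

/-- The inverse limit of a sequence of groups `Q k` with the maps `π k l : Q l → Q k`, `k ≤ l`,
realized as the subgroup of compatible sequences in the product. -/
def invLimit (Q : ℕ → Type) [∀ k, Group (Q k)] (π : ∀ k l : ℕ, k ≤ l → Q l →* Q k) :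
    Subgroup (∀ k, Q k) where
  carrier := {x | ∀ (k l : ℕ) (h : k ≤ l), π k l h (x l) = x k}
  one_mem' := fun _ _ _ => map_one _
  mul_mem' := fun {x y} hx hy k l h => by
    rw [Pi.mul_apply, map_mul, hx k l h, hy k l h, Pi.mul_apply]
  inv_mem' := fun {x} hx k l h => by
    rw [Pi.inv_apply, map_inv, hx k l h, Pi.inv_apply]

/-- The natural projection `G / N → G / M` for normal subgroups `N ≤ M` of `G`. -/
def quotientProj {G : Type} [Group G] {N M : Subgroup G} [N.Normal] [M.Normal] (h : N ≤ M) :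
    G ⧸ N →* G ⧸ M :=
  QuotientGroup.map N M (MonoidHom.id G) fun _ hx => h hx

section Completions

variable {d : ℕ} (G : Subgroup (TreeAut d))

/-- The congruence completion: the inverse limit of `G / St(k)` over the levels `k ≥ 1`
(the `k`-th coordinate belongs to the level `k + 1`). -/
def congruenceCompletion : Subgroup (∀ k : ℕ, G ⧸ levelStab G (k + 1)) :=
  invLimit (fun k => G ⧸ levelStab G (k + 1)) fun _ _ h =>
    quotientProj (levelStab_antitone G (Nat.succ_le_succ h))

/-- The branch completion: the inverse limit of `G / Rist(k)` over the levels `k ≥ 1`. -/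
def branchCompletion : Subgroup (∀ k : ℕ, G ⧸ levelRist G (k + 1)) :=
  invLimit (fun k => G ⧸ levelRist G (k + 1)) fun _ _ h =>
    quotientProj (levelRist_antitone G (Nat.succ_le_succ h))

/-- The natural projection `G / Rist(k) → G / St(k)`. -/
def ristToStab (k : ℕ) : G ⧸ levelRist G k →* G ⧸ levelStab G k :=
  quotientProj (levelRist_le_levelStab G k)

/-- The natural homomorphism from the branch completion to the congruence completion. -/
def branchToCongruence : branchCompletion G →* congruenceCompletion G where
  toFun x := ⟨fun k => ristToStab G (k + 1) (x.1 k), by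
    intro k l h
    have hx := x.2 k l h
    obtain ⟨g, hg⟩ := QuotientGroup.mk_surjective (x.1 l)
    rw [← hg] at hx
    dsimp only
    rw [← hg, ← hx]
    rfl⟩
  map_one' := Subtype.ext (funext fun _ => map_one _)
  map_mul' _ _ := Subtype.ext (funext fun _ => map_mul _ _ _)

/-- The rigid kernel of `G`. -/
def rigidKernel : Subgroup (branchCompletion G) :=
  (branchToCongruence G).ker

/-- The quotient `St(k) / Rist(k)`. -/
abbrev StabModRist (k : ℕ) : Type :=
  levelStab G k ⧸ (levelRist G k).subgroupOf (levelStab G k)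

/-- The map `St(l) / Rist(l) → St(k) / Rist(k)`, for `k ≤ l`, induced by the inclusions. -/
def stabModRistMap {k l : ℕ} (h : k ≤ l) : StabModRist G l →* StabModRist G k :=
  QuotientGroup.map _ _ (Subgroup.inclusion (levelStab_antitone G h))
    fun _ hx => levelRist_antitone G h hx

/-- The inverse limit of `St(k) / Rist(k)` over the levels `k ≥ 1`. -/
def stabModRistLimit : Subgroup (∀ k : ℕ, StabModRist G (k + 1)) :=
  invLimit (fun k => StabModRist G (k + 1)) fun _ _ h => stabModRistMap G (Nat.succ_le_succ h)

/-- The map `St(k) / Rist(k) → G / Rist(k)` induced by the inclusion of `St(k)` in `G`. -/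
def stabModRistIncl (k : ℕ) : StabModRist G k →* G ⧸ levelRist G k :=
  QuotientGroup.map _ _ (levelStab G k).subtype fun _ hx => hx

/-- The congruence subgroup property: every subgroup of finite index contains a level
stabilizer. -/
def CongruenceSubgroupProperty : Prop :=
  ∀ H : Subgroup G, H.FiniteIndex → ∃ k : ℕ, levelStab G k ≤ H

end Completions

/-! ### The groups `G_d` -/

/-- The action of the generator `a_i` on words. It exchanges the letters `i` and `i + 1` in first
position; its section is `a_i` at `i`, `a_{i+1}` at `i + 1`, and trivial at all other letters. -/
def genFun {d : ℕ} : ZMod d → Vertex d → Vertex d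
  | _, [] => []
  | i, x :: v =>
    if x = i then (i + 1) :: genFun i v
    else if x = i + 1 then i :: genFun (i + 1) v
    else x :: v

/-- The inverse of `genFun`. -/
def genInvFun {d : ℕ} : ZMod d → Vertex d → Vertex d
  | _, [] => []
  | i, x :: v =>
    if x = i + 1 then i :: genInvFun i v
    else if x = i then (i + 1) :: genInvFun (i + 1) v
    else x :: v

theorem genInvFun_genFun {d : ℕ} (i : ZMod d) (u : Vertex d) : genInvFun i (genFun i u) = u := by
  induction u generalizing i with
  | nil => rfl
  | cons x v ih =>
    by_cases h1 : x = i
    · simp [genFun, genInvFun, h1, ih]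
    · by_cases h2 : x = i + 1
      · have h3 : i ≠ i + 1 := fun h => h1 (h2.trans h.symm)
        rw [genFun, if_neg h1, if_pos h2, genInvFun, if_neg h3, if_pos rfl, ih, h2]
      · simp [genFun, genInvFun, h1, h2]

theorem genFun_genInvFun {d : ℕ} (i : ZMod d) (u : Vertex d) : genFun i (genInvFun i u) = u := by
  induction u generalizing i with
  | nil => rfl
  | cons x v ih =>
    by_cases h1 : x = i + 1
    · simp [genFun, genInvFun, h1, ih]
    · by_cases h2 : x = i
      · have h3 : i + 1 ≠ i := fun h => h1 (h2.trans h.symm)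
        rw [genInvFun, if_neg h1, if_pos h2, genFun, if_neg h3, if_pos rfl, ih, h2]
      · simp [genFun, genInvFun, h1, h2]

theorem genFun_append {d : ℕ} (i : ZMod d) (u : Vertex d) (x : ZMod d) :
    ∃ y, genFun i (u ++ [x]) = genFun i u ++ [y] := by
  induction u generalizing i with
  | nil =>
    simp only [List.nil_append, genFun]
    split_ifs <;> exact ⟨_, rfl⟩
  | cons z v ih =>
    obtain ⟨y, hy⟩ := ih i
    obtain ⟨y', hy'⟩ := ih (i + 1)
    by_cases h1 : z = i
    · exact ⟨y, by simp [genFun, h1, hy]⟩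
    · by_cases h2 : z = i + 1
      · exact ⟨y', by simp only [List.cons_append, genFun, if_neg h1, if_pos h2, hy']⟩
      · exact ⟨x, by simp [genFun, h1, h2]⟩

theorem genInvFun_append {d : ℕ} (i : ZMod d) (u : Vertex d) (x : ZMod d) :
    ∃ y, genInvFun i (u ++ [x]) = genInvFun i u ++ [y] := by
  induction u generalizing i with
  | nil =>
    simp only [List.nil_append, genInvFun]
    split_ifs <;> exact ⟨_, rfl⟩
  | cons z v ih =>
    obtain ⟨y, hy⟩ := ih i
    obtain ⟨y', hy'⟩ := ih (i + 1)
    by_cases h1 : z = i + 1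
    · exact ⟨y, by simp [genInvFun, h1, hy]⟩
    · by_cases h2 : z = i
      · exact ⟨y', by simp only [List.cons_append, genInvFun, if_neg h1, if_pos h2, hy']⟩
      · exact ⟨x, by simp [genInvFun, h1, h2]⟩

theorem genFun_adj {d : ℕ} (i : ZMod d) {u v : Vertex d} (h : (regularTree d).Adj u v) :
    (regularTree d).Adj (genFun i u) (genFun i v) := by
  rcases h with ⟨x, rfl⟩ | ⟨x, rfl⟩
  · exact Or.inl (genFun_append i u x)
  · exact Or.inr (genFun_append i v x)

theorem genInvFun_adj {d : ℕ} (i : ZMod d) {u v : Vertex d} (h : (regularTree d).Adj u v) :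
    (regularTree d).Adj (genInvFun i u) (genInvFun i v) := by
  rcases h with ⟨x, rfl⟩ | ⟨x, rfl⟩
  · exact Or.inl (genInvFun_append i u x)
  · exact Or.inr (genInvFun_append i v x)

/-- The generator `a_i`, defined by the wreath recursion
`a_i = (e, …, e, a_i, a_{i+1}, e, …, e) (i  i+1)` with the two sections at `i` and `i + 1`, the
indices being taken modulo `d`. -/
def treeGen {d : ℕ} (i : ZMod d) : TreeAut d :=
  ⟨{ toFun := genFun i
     invFun := genInvFun i
     left_inv := genInvFun_genFun i
     right_inv := genFun_genInvFun i
     map_rel_iff' := fun {u v} => ⟨fun h => by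
        have := genInvFun_adj i h
        rwa [Equiv.coe_fn_mk, genInvFun_genFun, genInvFun_genFun] at this, genFun_adj i⟩ }, rfl⟩

/-- The group `G_d`, generated by `a_1, …, a_d`. -/
def groupG (d : ℕ) : Subgroup (TreeAut d) :=
  Subgroup.closure (Set.range (treeGen (d := d)))

/-! The whole structure is governed by one invariant. Every relator between the generators has
exponent sum zero (`wordSum_eq_zero_of_eval_eq_one`), so the exponent sum is a homomorphism `expSum`
from the group to the integers. A generator has exactly two nontrivial sections, each a generator,
whence the exponent sums of the first-level sections of `g` add up to `2 * expSum g`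
(`sum_expSum_sec`). Generators act on letters as transpositions, so an element fixing the first
level has even exponent sum.

An element `g` can occur as the only nontrivial section, below one letter, of an element fixing the
first level if and only if `4 ∣ expSum g` (`mem_placed_iff`); oddness of `d` enters here, through
the invertibility of 2 modulo `d`. Iterating, the sections at level `k` may be replaced by any
others with the same exponent sums modulo `2 ^ (k + 1)` (`exists_secW_eq`). Consequently, for `k ≥
1`, Rist(k) consists of the elements of St(k) whose sections at level `k` have exponent sums
divisible by `2 ^ (k + 1)` (`mem_levelRist_succ_iff`).

An element of the limit of St(k)/Rist(k) is thus described by halved exponent sums `n v`, taken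
modulo `2 ^ k` at level `k` and subject only to `∑ x, n (v ++ [x]) = 2 * n v`. This relation
determines the value at `v ++ [0]` from `n v` and the values at the other children, while those
other values are free; all integer families satisfying it are realized
(`exists_mem_levelStab_expSum_secW`). At level `k` there are `d ^ k - d ^ (k - 1)` free vertices,
which gives the product. The same realization yields elements of exponent sum 2 in every level
stabilizer, so the kernel of `expSum` modulo 4 contains none of them. -/

/-! ### Sections of the elements of `G_d` -/

namespace GroupG

variable {d : ℕ}

/-- The generator `a_i` as an element of `G_d`. -/
def gen (i : ZMod d) : groupG d := ⟨treeGen i, Subgroup.subset_closure ⟨i, rfl⟩⟩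

theorem gen_smul (i : ZMod d) (u : Vertex d) : gen i • u = genFun i u := rfl

theorem ext_smul {g h : groupG d} (H : ∀ w : Vertex d, g • w = h • w) : g = h :=
  Subtype.ext (Subtype.ext (RelIso.ext H))

theorem closure_range_gen : Subgroup.closure (Set.range (gen (d := d))) = ⊤ := by
  have h : Set.range (gen (d := d)) = Subtype.val ⁻¹' Set.range (treeGen (d := d)) := by
    ext g
    exact ⟨fun ⟨i, hi⟩ => ⟨i, congrArg Subtype.val hi⟩, fun ⟨i, hi⟩ => ⟨i, Subtype.ext hi⟩⟩
  rw [h]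
  exact Subgroup.closure_closure_coe_preimage

theorem gen_induction {p : groupG d → Prop} (gen : ∀ i, p (gen i)) (one : p 1)
    (mul : ∀ g h, p g → p h → p (g * h)) (inv : ∀ g, p g → p g⁻¹) (g : groupG d) : p g := by
  have hg : g ∈ Subgroup.closure (Set.range (GroupG.gen (d := d))) := by
    rw [closure_range_gen]; trivial
  induction hg using Subgroup.closure_induction with
  | mem x hx => obtain ⟨i, rfl⟩ := hx; exact gen i
  | one => exact one
  | mul x y _ _ hx hy => exact mul x y hx hy
  | inv x _ hx => exact inv x hx

theorem exists_section (g : groupG d) (x : ZMod d) :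
    ∃ (y : ZMod d) (h : groupG d), ∀ w : Vertex d, g • (x :: w : Vertex d) = y :: h • w := by
  induction g using gen_induction generalizing x with
  | gen i =>
    by_cases h1 : x = i
    · exact ⟨i + 1, gen i, fun w => by simp [gen_smul, genFun, h1]⟩
    · by_cases h2 : x = i + 1
      · exact ⟨i, gen (i + 1), fun w => by
          rw [gen_smul, gen_smul, genFun, if_neg h1, if_pos h2]⟩
      · exact ⟨x, 1, fun w => by simp [gen_smul, genFun, h1, h2]⟩
  | one => exact ⟨x, 1, fun w => by simp⟩
  | mul g h hg hh =>
    obtain ⟨y, h', hy⟩ := hh x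
    obtain ⟨z, g', hz⟩ := hg y
    exact ⟨z, g' * h', fun w => by rw [mul_smul, hy, hz, mul_smul]⟩
  | inv g hg =>
    obtain ⟨z, hz⟩ := List.length_eq_one_iff.1 (length_smul_vertex (groupG d) g⁻¹ [x])
    obtain ⟨y, h, hy⟩ := hg z
    have h1 : y = x := by
      have := hy []
      rw [← hz, smul_inv_smul] at this
      simp only [List.cons.injEq] at this
      exact this.1.symm
    exact ⟨z, h⁻¹, fun w => by rw [inv_smul_eq_iff, hy, smul_inv_smul, h1]⟩

/-- The image of the letter `x` under `g`. -/
noncomputable def letter (g : groupG d) (x : ZMod d) : ZMod d := (exists_section g x).choose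

/-- The section of `g` at the letter `x`. -/
noncomputable def sec (g : groupG d) (x : ZMod d) : groupG d :=
  (exists_section g x).choose_spec.choose

theorem smul_cons (g : groupG d) (x : ZMod d) (w : Vertex d) :
    g • (x :: w : Vertex d) = letter g x :: sec g x • w :=
  (exists_section g x).choose_spec.choose_spec w

theorem letter_sec_unique {g h : groupG d} {x y : ZMod d}
    (H : ∀ w : Vertex d, g • (x :: w : Vertex d) = y :: h • w) : letter g x = y ∧ sec g x = h := by
  have h1 : ∀ w : Vertex d, letter g x = y ∧ sec g x • w = h • w := fun w => by
    have := H w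
    rw [smul_cons] at this
    exact List.cons.inj this
  exact ⟨(h1 []).1, ext_smul fun w => (h1 w).2⟩

theorem ext_letter_sec {g h : groupG d} (h1 : ∀ x, letter g x = letter h x)
    (h2 : ∀ x, sec g x = sec h x) : g = h := by
  refine ext_smul fun w => ?_
  cases w with
  | nil =>
    rw [List.eq_nil_of_length_eq_zero (length_smul_vertex _ g []),
      List.eq_nil_of_length_eq_zero (length_smul_vertex _ h [])]
  | cons x w => rw [smul_cons, smul_cons, h1, h2]

theorem smul_nil (g : groupG d) : g • ([] : Vertex d) = [] :=
  List.eq_nil_of_length_eq_zero (length_smul_vertex _ g [])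

@[simp] theorem letter_one (x : ZMod d) : letter (1 : groupG d) x = x :=
  (letter_sec_unique (h := 1) fun w => by simp).1

@[simp] theorem sec_one (x : ZMod d) : sec (1 : groupG d) x = 1 :=
  (letter_sec_unique (y := x) fun w => by simp).2

theorem letter_sec_mul (g h : groupG d) (x : ZMod d) :
    letter (g * h) x = letter g (letter h x) ∧ sec (g * h) x = sec g (letter h x) * sec h x :=
  letter_sec_unique fun w => by rw [mul_smul, smul_cons, smul_cons, mul_smul]

@[simp] theorem letter_mul (g h : groupG d) (x : ZMod d) :
    letter (g * h) x = letter g (letter h x) := (letter_sec_mul g h x).1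

@[simp] theorem sec_mul (g h : groupG d) (x : ZMod d) :
    sec (g * h) x = sec g (letter h x) * sec h x := (letter_sec_mul g h x).2

@[simp] theorem letter_inv_letter (g : groupG d) (x : ZMod d) : letter g⁻¹ (letter g x) = x := by
  rw [← letter_mul, inv_mul_cancel, letter_one]

@[simp] theorem letter_letter_inv (g : groupG d) (x : ZMod d) : letter g (letter g⁻¹ x) = x := by
  rw [← letter_mul, mul_inv_cancel, letter_one]

theorem sec_inv (g : groupG d) (x : ZMod d) : sec g⁻¹ x = (sec g (letter g⁻¹ x))⁻¹ := by
  have h := sec_mul g g⁻¹ x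
  rw [mul_inv_cancel, sec_one] at h
  exact eq_inv_of_mul_eq_one_right h.symm

/-- The action of `G_d` on the letters. -/
noncomputable def letterPerm : groupG d →* Equiv.Perm (ZMod d) where
  toFun g := ⟨letter g, letter g⁻¹, letter_inv_letter g, letter_letter_inv g⟩
  map_one' := Equiv.ext letter_one
  map_mul' g h := Equiv.ext (letter_mul g h)

theorem letterPerm_apply (g : groupG d) (x : ZMod d) : letterPerm g x = letter g x := rfl

theorem letter_sec_gen (i x : ZMod d) :
    letter (gen i) x = (if x = i then i + 1 else if x = i + 1 then i else x) ∧
    sec (gen i) x = (if x = i then gen i else if x = i + 1 then gen (i + 1) else 1) :=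
  letter_sec_unique fun w => by
    rw [gen_smul, genFun]
    split_ifs <;> simp [gen_smul]

theorem letter_gen (i x : ZMod d) :
    letter (gen i) x = if x = i then i + 1 else if x = i + 1 then i else x :=
  (letter_sec_gen i x).1

theorem sec_gen (i x : ZMod d) :
    sec (gen i) x = if x = i then gen i else if x = i + 1 then gen (i + 1) else 1 :=
  (letter_sec_gen i x).2

theorem letterPerm_gen (i : ZMod d) : letterPerm (gen i) = Equiv.swap i (i + 1) := by
  ext x
  rw [letterPerm_apply, letter_gen, Equiv.swap_apply_def]

theorem letter_gen_inv (i x : ZMod d) :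
    letter (gen i)⁻¹ x = if x = i then i + 1 else if x = i + 1 then i else x := by
  rw [← letterPerm_apply, map_inv, letterPerm_gen, Equiv.swap_inv, Equiv.swap_apply_def]

/-- The section of `g` at the vertex `v`. -/
noncomputable def secW (g : groupG d) (v : Vertex d) : groupG d := v.foldl sec g

@[simp] theorem secW_nil (g : groupG d) : secW g [] = g := rfl

@[simp] theorem secW_cons (g : groupG d) (x : ZMod d) (v : Vertex d) :
    secW g (x :: v) = secW (sec g x) v := rfl

theorem secW_append (g : groupG d) (u v : Vertex d) : secW g (u ++ v) = secW (secW g u) v :=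
  List.foldl_append

theorem smul_append (g : groupG d) (u v : Vertex d) :
    g • (u ++ v : Vertex d) = g • u ++ secW g u • v := by
  induction u generalizing g with
  | nil => simp [smul_nil]
  | cons x u ih => rw [List.cons_append, smul_cons, smul_cons, ih, secW_cons, List.cons_append]

theorem secW_one (v : Vertex d) : secW (1 : groupG d) v = 1 := by
  induction v with
  | nil => rfl
  | cons x v ih => rw [secW_cons, sec_one, ih]

theorem secW_mul (g h : groupG d) (v : Vertex d) :
    secW (g * h) v = secW g (h • v) * secW h v := by
  induction v generalizing g h with
  | nil => simp [smul_nil]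
  | cons x v ih => rw [secW_cons, sec_mul, ih, smul_cons, secW_cons, secW_cons]

theorem secW_inv_of_smul_eq {g : groupG d} {v : Vertex d} (h : g • v = v) :
    secW g⁻¹ v = (secW g v)⁻¹ := by
  have h1 := secW_mul g⁻¹ g v
  rw [inv_mul_cancel, secW_one, h] at h1
  exact eq_inv_of_mul_eq_one_left h1.symm

theorem ext_secW (k : ℕ) {g h : groupG d} (h1 : ∀ v : Vertex d, v.length = k → g • v = h • v)
    (h2 : ∀ v : Vertex d, v.length = k → secW g v = secW h v) : g = h := by
  induction k generalizing g h with
  | zero => exact h2 [] rfl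
  | succ k ih =>
    have h3 : ∀ x (v : Vertex d), v.length = k →
        letter g x = letter h x ∧ sec g x • v = sec h x • v := fun x v hv => by
      have := h1 (x :: v) (by simp [hv])
      rw [smul_cons, smul_cons] at this
      exact List.cons.inj this
    exact ext_letter_sec (fun x => (h3 x (List.replicate k 0) (by simp)).1) fun x =>
      ih (fun v hv => (h3 x v hv).2) fun v hv => h2 (x :: v) (by simp [hv])

/-! ### The exponent sum -/

section Words

/-- The value of a word in the generators and their inverses. -/
def eval (w : List (ZMod d × Bool)) : groupG d :=
  (w.map fun l => cond l.2 (gen l.1) (gen l.1)⁻¹).prod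

/-- The sum of the weights `f b` of the letters of a word, where `b` is the sign of the letter. -/
def weight (f : Bool → ℤ) (w : List (ZMod d × Bool)) : ℤ := (w.map fun l => f l.2).sum

/-- The exponent sum of a word. -/
abbrev wordSum (w : List (ZMod d × Bool)) : ℤ := weight (fun b => cond b 1 (-1)) w

/-- The word of length at most one that represents the section of a letter. -/
def letterSec (l : ZMod d × Bool) (x : ZMod d) : List (ZMod d × Bool) :=
  if x = l.1 then [(cond l.2 l.1 (l.1 + 1), l.2)]
  else if x = l.1 + 1 then [(cond l.2 (l.1 + 1) l.1, l.2)] else []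

/-- The word that represents the section of a word. -/
noncomputable def wordSec : List (ZMod d × Bool) → ZMod d → List (ZMod d × Bool)
  | [], _ => []
  | l :: w, x => letterSec l (letter (eval w) x) ++ wordSec w x

theorem eval_cons (l : ZMod d × Bool) (w : List (ZMod d × Bool)) :
    eval (l :: w) = eval [l] * eval w := by simp [eval]

theorem eval_append (v w : List (ZMod d × Bool)) : eval (v ++ w) = eval v * eval w := by
  simp [eval]

theorem weight_append (f : Bool → ℤ) (v w : List (ZMod d × Bool)) :
    weight f (v ++ w) = weight f v + weight f w := by simp [weight]

theorem weight_cons (f : Bool → ℤ) (l : ZMod d × Bool) (w : List (ZMod d × Bool)) :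
    weight f (l :: w) = f l.2 + weight f w := by simp [weight]

theorem weight_one (w : List (ZMod d × Bool)) : weight (fun _ => 1) w = w.length := by
  simp [weight]

theorem abs_wordSum_le (w : List (ZMod d × Bool)) : |wordSum w| ≤ w.length := by
  induction w with
  | nil => simp [weight]
  | cons l w ih =>
    rw [wordSum, weight_cons, List.length_cons]
    refine (abs_add_le _ _).trans ?_
    have : |cond l.2 (1 : ℤ) (-1)| = 1 := by cases l.2 <;> simp
    rw [this]
    push_cast
    linarith

theorem letter_eval_singleton (l : ZMod d × Bool) (x : ZMod d) :
    letter (eval [l]) x = if x = l.1 then l.1 + 1 else if x = l.1 + 1 then l.1 else x := by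
  rcases l with ⟨i, b⟩
  cases b <;> simp [eval, letter_gen, letter_gen_inv]

theorem length_letterSec_le (l : ZMod d × Bool) (x : ZMod d) : (letterSec l x).length ≤ 1 := by
  unfold letterSec
  split_ifs <;> simp

theorem letterSec_eq_nil {l : ZMod d × Bool} {x : ZMod d} :
    letterSec l x = [] ↔ x ≠ l.1 ∧ x ≠ l.1 + 1 := by
  unfold letterSec
  split_ifs <;> simp [*]

theorem exists_eval_eq (g : groupG d) : ∃ w, eval w = g := by
  induction g using gen_induction with
  | gen i => exact ⟨[(i, true)], by simp [eval]⟩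
  | one => exact ⟨[], by simp [eval]⟩
  | mul g h hg hh =>
    obtain ⟨v, rfl⟩ := hg
    obtain ⟨w, rfl⟩ := hh
    exact ⟨v ++ w, eval_append v w⟩
  | inv g hg =>
    obtain ⟨w, rfl⟩ := hg
    refine ⟨FreeGroup.invRev w, ?_⟩
    induction w with
    | nil => simp [eval]
    | cons l w ih =>
      rw [FreeGroup.invRev_cons, eval_append, ih, eval_cons l w, mul_inv_rev]
      rcases l with ⟨i, b⟩
      cases b <;> simp [eval, FreeGroup.invRev]

theorem length_wordSec_le (w : List (ZMod d × Bool)) (x : ZMod d) :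
    (wordSec w x).length ≤ w.length := by
  induction w with
  | nil => simp [wordSec]
  | cons l w ih =>
    have := length_letterSec_le l (letter (eval w) x)
    simp only [wordSec, List.length_append, List.length_cons]
    omega

variable [hd : Fact (3 ≤ d)]

theorem natCast_ne_zero {n : ℕ} (h0 : 0 < n) (h : n < 3) : ((n : ℕ) : ZMod d) ≠ 0 := by
  rw [Ne, ZMod.natCast_eq_zero_iff]
  intro h1
  have := Nat.le_of_dvd h0 h1
  have := hd.out
  omega

theorem add_one_ne (i : ZMod d) : i + 1 ≠ i := by
  have := natCast_ne_zero (d := d) (n := 1) (by norm_num) (by norm_num)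
  simpa using this

theorem add_two_ne (i : ZMod d) : i + 1 + 1 ≠ i := by
  have := natCast_ne_zero (d := d) (n := 2) (by norm_num) (by norm_num)
  rw [add_assoc]
  norm_num
  simpa using this

instance : NeZero d := ⟨by have := hd.out; omega⟩

theorem eval_letterSec (l : ZMod d × Bool) (x : ZMod d) :
    eval (letterSec l x) = sec (eval [l]) x := by
  rcases l with ⟨i, b⟩
  have h1 := add_one_ne i
  cases b
  · by_cases hx : x = i
    · subst hx; simp [letterSec, eval, sec_inv, letter_gen_inv, sec_gen, h1]
    · by_cases hx' : x = i + 1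
      · subst hx'; simp [letterSec, eval, sec_inv, letter_gen_inv, sec_gen, h1]
      · simp [letterSec, eval, sec_inv, letter_gen_inv, sec_gen, hx, hx']
  · simp only [letterSec, eval, List.map_cons, List.map_nil, List.prod_cons, List.prod_nil,
      mul_one, cond_true, sec_gen]
    split_ifs <;> simp

theorem eval_wordSec (w : List (ZMod d × Bool)) (x : ZMod d) :
    eval (wordSec w x) = sec (eval w) x := by
  induction w with
  | nil => simp [wordSec, eval]
  | cons l w ih => rw [wordSec, eval_append, eval_letterSec, ih, eval_cons l w, sec_mul]

theorem sum_weight_letterSec (f : Bool → ℤ) (l : ZMod d × Bool) :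
    ∑ x, weight f (letterSec l x) = 2 * f l.2 := by
  have h : ∀ x, weight f (letterSec l x) =
      (if x = l.1 then f l.2 else 0) + if x = l.1 + 1 then f l.2 else 0 := fun x => by
    have h1 := add_one_ne l.1
    unfold letterSec
    by_cases hx : x = l.1
    · simp [weight, hx, h1.symm]
    · by_cases hx' : x = l.1 + 1
      · simp [weight, hx', h1]
      · simp [weight, hx, hx']
  simp only [h, Finset.sum_add_distrib, Finset.sum_ite_eq', Finset.mem_univ, if_true]
  ring

theorem sum_weight_wordSec (f : Bool → ℤ) (w : List (ZMod d × Bool)) :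
    ∑ x, weight f (wordSec w x) = 2 * weight f w := by
  induction w with
  | nil => simp [wordSec, weight]
  | cons l w ih =>
    simp only [wordSec, weight_append, Finset.sum_add_distrib, ih, weight_cons]
    have := Equiv.sum_comp (letterPerm (eval w)) fun x => weight f (letterSec l x)
    simp only [letterPerm_apply] at this
    rw [this, sum_weight_letterSec]
    ring

/-- In a relator with nonzero exponent sum that is as short as possible and, among those, has
the largest possible exponent sum, every section is empty or again such a relator. -/
theorem wordSec_eq_nil_or {n : ℕ} {A : ℤ} (hA0 : 0 < A)
    (hlt : ∀ w : List (ZMod d × Bool), w.length < n → eval w = 1 → wordSum w = 0)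
    (hle : ∀ w : List (ZMod d × Bool), w.length = n → eval w = 1 → |wordSum w| ≤ A)
    (hn : 0 < n) {w : List (ZMod d × Bool)} (hw : w.length = n) (h1 : eval w = 1)
    (hA : |wordSum w| = A) (x : ZMod d) :
    wordSec w x = [] ∨ (wordSec w x).length = n ∧ eval (wordSec w x) = 1 ∧
      |wordSum (wordSec w x)| = A := by
  have hev : ∀ y, eval (wordSec w y) = 1 := fun y => by rw [eval_wordSec, h1, sec_one]
  -- The exponent sum per letter of any section is at most `A / n`. In total the sections have
  -- length `2n` and exponent sum of absolute value `2A`, so this bound is attained by every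
  -- section; a section shorter than `n` has exponent sum zero and must then be empty.
  have hterm : ∀ y, (n : ℤ) * |wordSum (wordSec w y)| ≤ A * (wordSec w y).length := fun y => by
    rcases (length_wordSec_le w y).lt_or_eq with h | h
    · rw [hlt _ (hw ▸ h) (hev y), abs_zero, mul_zero]
      positivity
    · rw [h, hw, mul_comm]
      exact mul_le_mul_of_nonneg_right (hle _ (h.trans hw) (hev y)) (by positivity)
  have hsum : ∑ y, A * ((wordSec w y).length : ℤ) ≤ ∑ y, (n : ℤ) * |wordSum (wordSec w y)| := by
    rw [← Finset.mul_sum, ← Finset.mul_sum]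
    have h2 := sum_weight_wordSec (fun _ => 1) w
    simp only [weight_one] at h2
    rw [h2, hw]
    have h3 := Finset.abs_sum_le_sum_abs (fun y => wordSum (wordSec w y)) Finset.univ
    rw [sum_weight_wordSec, abs_mul, abs_two, hA] at h3
    nlinarith
  have heq := (Finset.sum_eq_sum_iff_of_le fun y _ => hterm y).1
    (le_antisymm (Finset.sum_le_sum fun y _ => hterm y) hsum) x (Finset.mem_univ x)
  rcases (length_wordSec_le w x).lt_or_eq with h | h
  · rw [hlt _ (hw ▸ h) (hev x), abs_zero, mul_zero] at heq
    exact Or.inl (List.eq_nil_of_length_eq_zero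
      (by exact_mod_cast (mul_eq_zero.1 heq.symm).resolve_left hA0.ne'))
  · refine Or.inr ⟨h.trans hw, hev x, ?_⟩
    rw [h, hw, mul_comm A] at heq
    exact mul_left_cancel₀ (by positivity) heq

/-- If the indices differed, some letter would be met by `l₁` and then moved outside the two letters
met by `l₀`. The corresponding section would contain a letter from `l₁` and none from `l₀`, so its
length would lie strictly between 0 and `n`. -/
theorem fst_eq_of_wordSec {n : ℕ} {l₀ l₁ : ZMod d × Bool} {w : List (ZMod d × Bool)}
    (hw : (l₀ :: l₁ :: w).length = n)
    (h : ∀ x, wordSec (l₀ :: l₁ :: w) x = [] ∨ (wordSec (l₀ :: l₁ :: w) x).length = n) :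
    l₀.1 = l₁.1 := by
  by_contra hne
  obtain ⟨p, hp, hp'⟩ : ∃ p, letterSec l₁ p ≠ [] ∧ letterSec l₀ (letter (eval [l₁]) p) = [] := by
    have a1 := add_one_ne l₁.1
    have a2 := add_two_ne l₀.1
    by_cases h1 : l₁.1 = l₀.1 + 1
    · refine ⟨l₁.1, by simp [letterSec], ?_⟩
      rw [letterSec_eq_nil, letter_eval_singleton, if_pos rfl, h1]
      exact ⟨a2, add_one_ne _⟩
    · refine ⟨l₁.1 + 1, by rw [Ne, letterSec_eq_nil]; simp, ?_⟩
      rw [letterSec_eq_nil, letter_eval_singleton, if_neg a1, if_pos rfl]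
      exact ⟨fun h => hne h.symm, h1⟩
  have hsec : wordSec (l₀ :: l₁ :: w) (letter (eval w)⁻¹ p) =
      letterSec l₁ p ++ wordSec w (letter (eval w)⁻¹ p) := by
    rw [wordSec, wordSec, eval_cons l₁ w, letter_mul, letter_letter_inv, hp', List.nil_append]
  rcases h (letter (eval w)⁻¹ p) with h1 | h1
  · rw [hsec] at h1
    exact hp (List.append_eq_nil_iff.1 h1).1
  · rw [hsec, ← hw] at h1
    have b1 := length_letterSec_le l₁ p
    have b2 := length_wordSec_le w (letter (eval w)⁻¹ p)
    simp only [List.length_append, List.length_cons] at h1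
    omega

/-- The first two letters of an extremal relator have the same index, and also the same sign, since
otherwise they cancel and leave a shorter relator with the same exponent sum. But the square of a
generator has a section that is a product of two generators with different indices (or of their
inverses), and the section of the relator there is again extremal. -/
theorem not_exists_extremal_relator {n : ℕ} {A : ℤ} (hA0 : 0 < A)
    (hlt : ∀ w : List (ZMod d × Bool), w.length < n → eval w = 1 → wordSum w = 0)
    (hle : ∀ w : List (ZMod d × Bool), w.length = n → eval w = 1 → |wordSum w| ≤ A)
    {w : List (ZMod d × Bool)} (hw : w.length = n) (h1 : eval w = 1) (hA : |wordSum w| = A) :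
    False := by
  rcases w with _ | ⟨l₀, _ | ⟨l₁, w⟩⟩
  · simp [weight] at hA
    omega
  · have h2 := letter_eval_singleton l₀ l₀.1
    rw [h1, letter_one, if_pos rfl] at h2
    exact add_one_ne _ h2.symm
  have hn : 0 < n := by simp at hw; omega
  have hsame : l₀.1 = l₁.1 := fst_eq_of_wordSec hw fun x =>
    (wordSec_eq_nil_or hA0 hlt hle hn hw h1 hA x).imp_right And.left
  have hsign : l₀.2 = l₁.2 := by
    by_contra hne
    have h2 : eval w = 1 := by
      rw [← h1]
      rcases l₀ with ⟨i, b⟩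
      rcases l₁ with ⟨j, c⟩
      obtain rfl : i = j := hsame
      cases b <;> cases c <;> simp_all [eval]
    have h3 : wordSum (l₀ :: l₁ :: w) = wordSum w := by
      simp only [wordSum, weight_cons]
      cases h : l₀.2 <;> cases h' : l₁.2 <;> simp_all
    rw [h3, hlt w (by simp at hw; omega) h2] at hA
    simp at hA
    omega
  obtain rfl : l₀ = l₁ := Prod.ext hsame hsign
  have key : ∃ x m₀ m₁, wordSec (l₀ :: l₀ :: w) x = m₀ :: m₁ :: wordSec w x ∧ m₀.1 ≠ m₁.1 := by
    refine ⟨letter (eval w)⁻¹ l₀.1, (cond l₀.2 (l₀.1 + 1) l₀.1, l₀.2),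
      (cond l₀.2 l₀.1 (l₀.1 + 1), l₀.2), ?_, ?_⟩
    · rw [wordSec, wordSec, eval_cons l₀ w, letter_mul, letter_letter_inv,
        letter_eval_singleton, if_pos rfl]
      simp only [letterSec, if_neg (add_one_ne _), if_true]
      rfl
    · cases l₀.2
      · exact (add_one_ne _).symm
      · exact add_one_ne _
  obtain ⟨x, m₀, m₁, hx, hm⟩ := key
  obtain ⟨h2, h3, h4⟩ := (wordSec_eq_nil_or hA0 hlt hle hn hw h1 hA x).resolve_left (by simp [hx])
  rw [hx] at h2 h3 h4
  exact hm (fst_eq_of_wordSec h2 fun y =>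
    (wordSec_eq_nil_or hA0 hlt hle hn h2 h3 h4 y).imp_right And.left)

theorem wordSum_eq_zero_of_eval_eq_one {w : List (ZMod d × Bool)} (h1 : eval w = 1) :
    wordSum w = 0 := by
  induction hn : w.length using Nat.strong_induction_on generalizing w with
  | _ n ih =>
    by_contra hne
    have hlt : ∀ w : List (ZMod d × Bool), w.length < n → eval w = 1 → wordSum w = 0 :=
      fun w hw h => ih _ hw h rfl
    -- At fixed length the absolute exponent sum is bounded by the length, so this inner induction
    -- reaches a relator for which it is maximal.
    induction hm : n - (wordSum w).natAbs using Nat.strong_induction_on generalizing w with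
    | _ m ihm =>
      refine not_exists_extremal_relator (abs_pos.2 hne) hlt (fun v hv hv1 => ?_) hn h1 rfl
      by_contra! hvw
      have h2 := abs_wordSum_le v
      simp only [Int.abs_eq_natAbs] at h2 hvw
      refine ihm (n - (wordSum v).natAbs) (by omega) hv1 hv ?_ rfl
      intro h0
      rw [h0] at hvw
      omega

end Words

variable [hd : Fact (3 ≤ d)]

/-! ### The exponent sum as a homomorphism to the integers -/

theorem wordSum_eq_of_eval_eq {v w : List (ZMod d × Bool)} (h : eval v = eval w) :
    wordSum v = wordSum w := by
  obtain ⟨u, hu⟩ := exists_eval_eq (eval w)⁻¹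
  have h1 : wordSum (v ++ u) = 0 := wordSum_eq_zero_of_eval_eq_one (by
    rw [eval_append, hu, h, mul_inv_cancel])
  have h2 : wordSum (w ++ u) = 0 := wordSum_eq_zero_of_eval_eq_one (by
    rw [eval_append, hu, mul_inv_cancel])
  rw [wordSum, weight_append] at h1 h2
  simp only [wordSum]
  omega

/-- The exponent sum of an element of `G_d`. -/
noncomputable def expSum (g : groupG d) : ℤ := wordSum (exists_eval_eq g).choose

theorem expSum_eval (w : List (ZMod d × Bool)) : expSum (eval w) = wordSum w :=
  wordSum_eq_of_eval_eq (exists_eval_eq (eval w)).choose_spec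

@[simp] theorem expSum_mul (g h : groupG d) : expSum (g * h) = expSum g + expSum h := by
  obtain ⟨v, rfl⟩ := exists_eval_eq g
  obtain ⟨w, rfl⟩ := exists_eval_eq h
  rw [← eval_append, expSum_eval, expSum_eval, expSum_eval, wordSum, weight_append]

@[simp] theorem expSum_one : expSum (1 : groupG d) = 0 := by
  have := expSum_mul (1 : groupG d) 1
  rw [mul_one] at this
  omega

@[simp] theorem expSum_inv (g : groupG d) : expSum g⁻¹ = -expSum g := by
  have := expSum_mul g⁻¹ g
  rw [inv_mul_cancel, expSum_one] at this
  omega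

@[simp] theorem expSum_gen (i : ZMod d) : expSum (gen i) = 1 := by
  have : gen i = eval [(i, true)] := by simp [eval]
  rw [this, expSum_eval]
  simp [weight]

@[simp] theorem expSum_zpow (g : groupG d) (n : ℤ) : expSum (g ^ n) = n * expSum g := by
  let f : Additive (groupG d) →+ ℤ :=
    ⟨⟨fun g => expSum g.toMul, expSum_one⟩, fun _ _ => expSum_mul _ _⟩
  have := map_zsmul f n (Additive.ofMul g)
  exact this.trans (smul_eq_mul _ _)

theorem sum_expSum_sec (g : groupG d) : ∑ x, expSum (sec g x) = 2 * expSum g := by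
  obtain ⟨w, rfl⟩ := exists_eval_eq g
  simp_rw [← eval_wordSec, expSum_eval]
  exact sum_weight_wordSec _ w

theorem sign_letterPerm (g : groupG d) :
    (Equiv.Perm.sign (letterPerm g) : ℤˣ) = (-1) ^ expSum g := by
  induction g using gen_induction with
  | gen i => rw [letterPerm_gen, Equiv.Perm.sign_swap (add_one_ne i).symm, expSum_gen, zpow_one]
  | one => simp
  | mul g h hg hh => rw [map_mul, map_mul, hg, hh, expSum_mul, zpow_add]
  | inv g hg => rw [map_inv, map_inv, hg, expSum_inv, zpow_neg]

theorem even_expSum {g : groupG d} (h : ∀ x, letter g x = x) : Even (expSum g) := by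
  have h1 : letterPerm g = 1 := Equiv.ext h
  have h2 := sign_letterPerm g
  rw [h1, map_one] at h2
  by_contra h3
  rw [Int.not_even_iff_odd] at h3
  rw [h3.neg_one_zpow] at h2
  exact absurd h2 (by decide)

end GroupG

/-! ### Elements of `G_d` supported below one letter -/

namespace GroupG

variable {d : ℕ}

/-- The elements `g` of `G_d` for which the automorphism with section `g` at the letter `x`, and
trivial action elsewhere, belongs to `G_d`. -/
def placed (x : ZMod d) : Subgroup (groupG d) where
  carrier := {g | ∃ h : groupG d, (∀ y, letter h y = y) ∧ (∀ y, y ≠ x → sec h y = 1) ∧ sec h x = g}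
  one_mem' := ⟨1, by simp, by simp, by simp⟩
  mul_mem' := by
    rintro _ _ ⟨g, g1, g2, rfl⟩ ⟨h, h1, h2, rfl⟩
    exact ⟨g * h, fun y => by rw [letter_mul, h1, g1],
      fun y hy => by rw [sec_mul, h1, g2 y hy, h2 y hy, one_mul], by rw [sec_mul, h1]⟩
  inv_mem' := by
    rintro _ ⟨g, g1, g2, rfl⟩
    have h1 : ∀ y, letter g⁻¹ y = y := fun y => by
      conv_lhs => rw [← g1 y]
      exact letter_inv_letter g y
    exact ⟨g⁻¹, h1, fun y hy => by rw [sec_inv, h1, g2 y hy, inv_one], by rw [sec_inv, h1]⟩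

/-- Conjugation by `u` carries an element supported below `x` to one supported below `y`. A suitable
choice of `u` shows that `placed x` is normal and that it does not depend on `x`. -/
theorem conj_mem_placed {g u : groupG d} {x y : ZMod d} (hg : g ∈ placed x) (hu : letter u x = y) :
    sec u x * g * (sec u x)⁻¹ ∈ placed y := by
  obtain ⟨h, h1, h2, rfl⟩ := hg
  have hx : letter u⁻¹ y = x := by rw [← hu, letter_inv_letter]
  refine ⟨u * h * u⁻¹, fun z => by simp [h1], fun z hz => ?_, ?_⟩
  · have hz' : letter u⁻¹ z ≠ x := fun h => hz (by rw [← hu, ← h, letter_letter_inv])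
    rw [sec_mul, sec_mul, h1, h2 _ hz', sec_inv, mul_one, mul_inv_cancel]
  · rw [sec_mul, sec_mul, sec_inv, hx, h1]

/-- Sections can be changed independently of each other by elements of `placed`. -/
theorem exists_sec_eq [NeZero d] (f : groupG d) (h : ZMod d → groupG d)
    (hf : ∀ y, (sec f y)⁻¹ * h y ∈ placed y) :
    ∃ g : groupG d, (∀ y, letter g y = letter f y) ∧ ∀ y, sec g y = h y := by
  have key : ∀ S : Finset (ZMod d), ∃ p : groupG d, (∀ y, letter p y = y) ∧
      ∀ y, sec p y = if y ∈ S then (sec f y)⁻¹ * h y else 1 := by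
    intro S
    induction S using Finset.induction_on with
    | empty => exact ⟨1, by simp, by simp⟩
    | insert x S hx ih =>
      obtain ⟨p, p1, p2⟩ := ih
      obtain ⟨q, q1, q2, q3⟩ := hf x
      refine ⟨p * q, fun y => by rw [letter_mul, q1, p1], fun y => ?_⟩
      rw [sec_mul, q1, p2]
      by_cases hy : y = x
      · subst hy
        simp [hx, q3]
      · simp [q2 y hy, hy]
  obtain ⟨p, p1, p2⟩ := key Finset.univ
  exact ⟨f * p, fun y => by rw [letter_mul, p1], fun y => by
    rw [sec_mul, p1, p2, if_pos (Finset.mem_univ y), mul_inv_cancel_left]⟩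

section Transport

variable [hd : Fact (3 ≤ d)]

theorem exists_nat_two_mul (hodd : Odd d) (x : ZMod d) : ∃ n : ℕ, ((2 * n : ℕ) : ZMod d) = x := by
  obtain ⟨m, hm⟩ := hodd
  refine ⟨(m + 1) * x.val, ?_⟩
  have h : ((2 * (m + 1) : ℕ) : ZMod d) = 1 := by
    have : 2 * (m + 1) = d + 1 := by omega
    rw [this]
    simp
  rw [← mul_assoc, Nat.cast_mul, h, one_mul, ZMod.natCast_zmod_val]

theorem exists_letter_eq_sec_eq_one (hodd : Odd d) (x y : ZMod d) :
    ∃ u : groupG d, letter u x = y ∧ sec u x = 1 := by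
  have key : ∀ n : ℕ, ∃ u : groupG d, letter u x = x + (2 * n : ℕ) ∧ sec u x = 1 := by
    intro n
    induction n with
    | zero => exact ⟨1, by simp, by simp⟩
    | succ n ih =>
      obtain ⟨u, u1, u2⟩ := ih
      set z := x + (2 * n : ℕ) with hz
      have h1 := add_one_ne z
      -- The element `gen (z + 1) * (gen z)⁻¹` moves `z` to `z + 2`, and its two sections along the
      -- way, the inverse of `gen (z + 1)` and `gen (z + 1)`, cancel. Steps of 2 reach every letter
      -- because `d` is odd.
      refine ⟨gen (z + 1) * (gen z)⁻¹ * u, ?_, ?_⟩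
      · rw [letter_mul, letter_mul, u1, letter_gen_inv, if_pos rfl, letter_gen, if_pos rfl, hz]
        push_cast
        ring
      · rw [sec_mul, sec_mul, u1, u2, sec_inv, letter_gen_inv, if_pos rfl, sec_gen, sec_gen,
          if_pos rfl, if_neg h1, if_pos rfl, mul_inv_cancel, one_mul]
  obtain ⟨n, hn⟩ := exists_nat_two_mul hodd (y - x)
  obtain ⟨u, u1, u2⟩ := key n
  exact ⟨u, by rw [u1, hn, add_sub_cancel], u2⟩

/-- `G_d` is self-replicating. -/
theorem exists_letter_eq_self_sec_eq (hodd : Odd d) (x : ZMod d) (g : groupG d) :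
    ∃ u : groupG d, letter u x = x ∧ sec u x = g := by
  induction g using gen_induction with
  | gen i =>
    obtain ⟨u, u1, u2⟩ := exists_letter_eq_sec_eq_one hodd x i
    obtain ⟨v, v1, v2⟩ := exists_letter_eq_sec_eq_one hodd (i + 1) x
    refine ⟨v * gen i * u, ?_, ?_⟩
    · rw [letter_mul, letter_mul, u1, letter_gen, if_pos rfl, v1]
    · rw [sec_mul, sec_mul, u1, u2, letter_gen, if_pos rfl, v2, sec_gen, if_pos rfl, one_mul,
        mul_one]
  | one => exact ⟨1, by simp, by simp⟩
  | mul g h hg hh =>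
    obtain ⟨u, u1, u2⟩ := hg
    obtain ⟨v, v1, v2⟩ := hh
    exact ⟨u * v, by rw [letter_mul, v1, u1], by rw [sec_mul, v1, u2, v2]⟩
  | inv g hg =>
    obtain ⟨u, u1, u2⟩ := hg
    have h1 : letter u⁻¹ x = x := by
      conv_lhs => rw [← u1]
      exact letter_inv_letter u x
    exact ⟨u⁻¹, h1, by rw [sec_inv, h1, u2]⟩

theorem placed_normal (hodd : Odd d) (x : ZMod d) : (placed x).Normal := by
  refine ⟨fun g hg h => ?_⟩
  obtain ⟨u, u1, u2⟩ := exists_letter_eq_self_sec_eq hodd x h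
  exact u2 ▸ conj_mem_placed hg u1

theorem placed_le (hodd : Odd d) (x y : ZMod d) : placed x ≤ placed y := by
  intro g hg
  obtain ⟨u, u1, u2⟩ := exists_letter_eq_sec_eq_one hodd x y
  simpa [u2] using conj_mem_placed hg u1

/-! ### The elements that can be placed below a single letter -/

theorem letter_conj_gen (i : ZMod d) (x : ZMod d) :
    letter (gen i * gen (i + 1) * (gen i)⁻¹) x = Equiv.swap i (i + 1 + 1) x ∧
    letter ((gen (i + 1))⁻¹ * gen i * gen (i + 1)) x = Equiv.swap i (i + 1 + 1) x := by
  have h1 := add_one_ne i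
  have h2 := add_one_ne (i + 1)
  have h3 := add_two_ne i
  constructor
  · simp only [letter_mul, letter_gen, letter_gen_inv, Equiv.swap_apply_def]
    grind
  · simp only [letter_mul, letter_gen, letter_gen_inv, Equiv.swap_apply_def]
    grind

theorem sec_conj_gen (i : ZMod d) (x : ZMod d) :
    sec (gen i * gen (i + 1) * (gen i)⁻¹) x =
      if x = i + 1 + 1 then gen (i + 1) * gen (i + 1 + 1) else 1 := by
  have h1 := add_one_ne i
  have h2 := add_one_ne (i + 1)
  have h3 := add_two_ne i
  simp only [sec_mul, sec_inv, sec_gen, letter_gen, letter_gen_inv]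
  obtain rfl | rfl | rfl | ⟨hx, hx', hx''⟩ : x = i ∨ x = i + 1 ∨ x = i + 1 + 1 ∨
      x ≠ i ∧ x ≠ i + 1 ∧ x ≠ i + 1 + 1 := by tauto
  all_goals simp [*, h1.symm, h2.symm, h3.symm]

theorem sec_conj_gen' (i : ZMod d) (x : ZMod d) :
    sec ((gen (i + 1))⁻¹ * gen i * gen (i + 1)) x =
      if x = i then (gen (i + 1 + 1))⁻¹ * gen i
      else if x = i + 1 + 1 then gen (i + 1) * gen (i + 1 + 1) else 1 := by
  have h1 := add_one_ne i
  have h2 := add_one_ne (i + 1)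
  have h3 := add_two_ne i
  simp only [sec_mul, sec_inv, sec_gen, letter_gen, letter_gen_inv]
  obtain rfl | rfl | rfl | ⟨hx, hx', hx''⟩ : x = i ∨ x = i + 1 ∨ x = i + 1 + 1 ∨
      x ≠ i ∧ x ≠ i + 1 ∧ x ≠ i + 1 + 1 := by tauto
  all_goals simp [*, h1.symm, h2.symm, h3.symm]

/-- The two conjugates `t` and `t'` act on the letters as the same transposition of `i` and `i + 2`,
and their sections differ only at `i`. Hence `t⁻¹ * t'` is supported below `i`. -/
theorem inv_gen_mul_gen_mem_placed (i : ZMod d) :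
    (gen (i + 1 + 1))⁻¹ * gen i ∈ placed i := by
  have h3 := add_two_ne i
  set t := gen i * gen (i + 1) * (gen i)⁻¹ with ht
  set t' := (gen (i + 1))⁻¹ * gen i * gen (i + 1) with ht'
  have l1 : ∀ x, letter t x = letter t' x := fun x => by
    rw [(letter_conj_gen i x).1, (letter_conj_gen i x).2]
  have l2 : ∀ x, letter t⁻¹ (letter t' x) = x := fun x => by rw [← l1, letter_inv_letter]
  have l3 : ∀ x, sec (t⁻¹ * t') x = (sec t x)⁻¹ * sec t' x := fun x => by
    rw [sec_mul, sec_inv, l2]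
  refine ⟨t⁻¹ * t', fun x => by rw [letter_mul, l2], fun y hy => ?_, ?_⟩
  · rw [l3, sec_conj_gen, sec_conj_gen', if_neg hy, inv_mul_cancel]
  · rw [l3, sec_conj_gen, sec_conj_gen', if_pos rfl, if_neg h3.symm, inv_one, one_mul]

/-- Modulo the normal subgroup `placed x` the generators with indices `i` and `i + 2` agree, hence
all generators agree since `d` is odd. The quotient is therefore cyclic, and the class of `g`
depends only on `expSum g`. -/
theorem mem_placed_of_expSum_eq_zero (hodd : Odd d) {g : groupG d} (hg : expSum g = 0)
    (x : ZMod d) : g ∈ placed x := by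
  have := placed_normal hodd x
  have hgen : ∀ i, ((gen i : groupG d) : groupG d ⧸ placed x) = (gen (0 : ZMod d) : groupG d) := by
    have h : ∀ n : ℕ, ((gen ((2 * n : ℕ) : ZMod d) : groupG d) : groupG d ⧸ placed x) =
        (gen (0 : ZMod d) : groupG d) := by
      intro n
      induction n with
      | zero => simp
      | succ n ih =>
        rw [← ih, QuotientGroup.eq]
        have e : ((2 * (n + 1) : ℕ) : ZMod d) = ((2 * n : ℕ) : ZMod d) + 1 + 1 := by
          push_cast
          ring
        rw [e]
        exact placed_le hodd _ x (inv_gen_mul_gen_mem_placed _)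
    intro i
    obtain ⟨n, rfl⟩ := exists_nat_two_mul hodd i
    exact h n
  have key : ∀ g : groupG d, (g : groupG d ⧸ placed x) =
      ((gen (0 : ZMod d) : groupG d) : groupG d ⧸ placed x) ^ expSum g := by
    intro g
    induction g using gen_induction with
    | gen i => rw [hgen, expSum_gen, zpow_one]
    | one => simp
    | mul g h hg hh => rw [QuotientGroup.mk_mul, hg, hh, expSum_mul, zpow_add]
    | inv g hg => rw [QuotientGroup.mk_inv, hg, expSum_inv, zpow_neg]
  have h1 := key g
  rw [hg, zpow_zero] at h1
  exact (QuotientGroup.eq_one_iff g).1 h1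

theorem exists_mem_placed_expSum_eq_four (hodd : Odd d) (i : ZMod d) :
    ∃ g ∈ placed i, expSum g = 4 := by
  have h1 := add_one_ne i
  have h2 := add_one_ne (i + 1)
  have h3 := add_two_ne i
  set t := gen i * gen (i + 1) * (gen i)⁻¹ with ht
  -- The exponent sums of the sections at `i`, `i + 1`, `i + 2` are 2, 2, 0 for the square of `gen
  -- i`; 2, 0, 2 for that of `t`; and 0, -2, -2 for the last two factors. They add up to 4, 0, 0;
  -- the remaining sections of exponent sum zero are removed below by `exists_sec_eq`.
  set f := gen i * gen i * (t * t) * (gen (i + 1))⁻¹ * (gen (i + 1))⁻¹ with hf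
  have key : ∀ j x : ZMod d, letter (gen j) (letter (gen j) x) = x := fun j x => by
    rw [← letterPerm_apply, ← letterPerm_apply, letterPerm_gen, Equiv.swap_apply_self]
  have key' : ∀ j x : ZMod d, letter (gen j)⁻¹ x = letter (gen j) x := fun j x => by
    rw [letter_gen_inv, letter_gen]
  have ltt : ∀ x, letter t (letter t x) = x := fun x => by
    rw [(letter_conj_gen i x).1, (letter_conj_gen i _).1, Equiv.swap_apply_self]
  have lf : ∀ x, letter f x = x := fun x => by
    simp only [hf, letter_mul]
    rw [key, ltt, key', key', key]
  have e : ∀ x, expSum (sec f x) = if x = i then 4 else 0 := fun x => by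
    simp only [hf, sec_mul, letter_mul, expSum_mul, sec_inv, key', key, expSum_inv, ltt]
    rw [(letter_conj_gen i x).1, sec_conj_gen, sec_conj_gen]
    obtain rfl | rfl | rfl | ⟨hx, hx', hx''⟩ : x = i ∨ x = i + 1 ∨ x = i + 1 + 1 ∨
        x ≠ i ∧ x ≠ i + 1 ∧ x ≠ i + 1 + 1 := by tauto
    all_goals simp [*, h1.symm, h2.symm, h3.symm, sec_gen, letter_gen, Equiv.swap_apply_of_ne_of_ne]
  obtain ⟨g, g1, g2⟩ := exists_sec_eq f (fun y => if y = i then sec f i else 1) fun y =>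
    mem_placed_of_expSum_eq_zero hodd (by
      by_cases hy : y = i
      · subst hy; simp
      · simp [hy, e]) y
  refine ⟨sec f i, ⟨g, fun y => by rw [g1, lf], fun y hy => ?_, ?_⟩, by rw [e, if_pos rfl]⟩
  · rw [g2, if_neg hy]
  · rw [g2, if_pos rfl]

theorem mem_placed_iff (hodd : Odd d) {g : groupG d} {x : ZMod d} :
    g ∈ placed x ↔ 4 ∣ expSum g := by
  constructor
  · rintro ⟨h, h1, h2, rfl⟩
    obtain ⟨m, hm⟩ := even_expSum h1
    have := sum_expSum_sec h
    rw [Finset.sum_eq_single x (fun y _ hy => by rw [h2 y hy, expSum_one]) (by simp)] at this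
    exact ⟨m, by omega⟩
  · rintro ⟨m, hm⟩
    obtain ⟨f, f1, f2⟩ := exists_mem_placed_expSum_eq_four hodd x
    have : g * (f ^ m)⁻¹ ∈ placed x := mem_placed_of_expSum_eq_zero hodd (by
      rw [expSum_mul, expSum_inv, expSum_zpow, hm, f2]; ring) x
    exact (Subgroup.mul_mem_cancel_right _ (inv_mem (zpow_mem f1 m))).1 this

end Transport

end GroupG

/-! ### Elements of `G_d` with prescribed sections at a level -/

namespace GroupG

variable {d : ℕ}

theorem exists_eq_append_singleton {k : ℕ} {u : Vertex d} (h : u.length = k + 1) :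
    ∃ v x, v.length = k ∧ u = v ++ [x] := by
  obtain ⟨v, x, rfl⟩ := (List.eq_nil_or_concat u).resolve_left (by rintro rfl; simp at h)
  exact ⟨v, x, by simpa using h, List.concat_eq_append⟩

theorem mem_levelStab_one_iff {g : groupG d} :
    g ∈ levelStab (groupG d) 1 ↔ ∀ x, letter g x = x := by
  rw [mem_levelStab]
  constructor
  · intro h x
    have := h [x] rfl
    rw [smul_cons] at this
    exact (List.cons.inj this).1
  · intro h u hu
    obtain ⟨x, rfl⟩ := List.length_eq_one_iff.1 hu
    rw [smul_cons, smul_nil, h]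

theorem mem_levelStab_succ_iff {k : ℕ} {g : groupG d} :
    g ∈ levelStab (groupG d) (k + 1) ↔ g ∈ levelStab (groupG d) k ∧
      ∀ v : Vertex d, v.length = k → secW g v ∈ levelStab (groupG d) 1 := by
  constructor
  · intro h
    have h1 := levelStab_antitone (groupG d) (Nat.le_succ k) h
    refine ⟨h1, fun v hv => ?_⟩
    rw [mem_levelStab] at h h1 ⊢
    intro u hu
    have := h (v ++ u) (by simp [hv, hu])
    rw [smul_append, h1 v hv] at this
    exact List.append_cancel_left this
  · rintro ⟨h1, h2⟩
    rw [mem_levelStab] at h1 ⊢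
    intro u hu
    obtain ⟨v, x, hv, rfl⟩ := exists_eq_append_singleton hu
    rw [smul_append, h1 v hv, (mem_levelStab _).1 (h2 v hv) [x] rfl]

theorem secW_mul_of_mem {k : ℕ} (g : groupG d) {h : groupG d} (hh : h ∈ levelStab (groupG d) k)
    {v : Vertex d} (hv : v.length = k) : secW (g * h) v = secW g v * secW h v := by
  rw [secW_mul, (mem_levelStab _).1 hh v hv]

theorem secW_inv_of_mem {k : ℕ} {g : groupG d} (hg : g ∈ levelStab (groupG d) k)
    {v : Vertex d} (hv : v.length = k) : secW g⁻¹ v = (secW g v)⁻¹ :=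
  secW_inv_of_smul_eq ((mem_levelStab _).1 hg v hv)

theorem sec_of_mem_vertexRist_cons {g : groupG d} {x : ZMod d} {u : Vertex d}
    (hg : g ∈ vertexRist (groupG d) (x :: u)) :
    (∀ y, y ≠ x → sec g y = 1) ∧ sec g x ∈ vertexRist (groupG d) u := by
  have h0 : ∀ y, y ≠ x → letter g y = y ∧ sec g y = 1 := fun y hy =>
    letter_sec_unique fun w => by
      rw [one_smul]
      exact (mem_vertexRist _).1 hg _ fun h => hy (List.cons_prefix_cons.1 h).1.symm
  refine ⟨fun y hy => (h0 y hy).2, ?_⟩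
  rw [mem_vertexRist]
  intro w hw
  have := (mem_vertexRist _).1 hg (x :: w) fun h => hw (List.cons_prefix_cons.1 h).2
  rw [smul_cons] at this
  exact (List.cons.inj this).2

theorem secW_of_mem_vertexRist {g : groupG d} {u v : Vertex d} (hg : g ∈ vertexRist (groupG d) u)
    (hv : v.length = u.length) (hne : v ≠ u) : secW g v = 1 := by
  refine ext_smul fun w => ?_
  have hp : ∀ w, ¬ u <+: v ++ w := fun w h =>
    hne ((List.prefix_of_prefix_length_le h (List.prefix_append v w) hv.ge).eq_of_length
      hv.symm).symm
  have h1 := (mem_vertexRist _).1 hg (v ++ w) (hp w)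
  have h2 := (mem_vertexRist _).1 hg v (by simpa using hp [])
  rw [smul_append, h2] at h1
  rw [one_smul]
  exact List.append_cancel_left h1

theorem mem_vertexRist_of_secW {k : ℕ} {g : groupG d} (hg : g ∈ levelStab (groupG d) k)
    {u : Vertex d} (h : ∀ v : Vertex d, v.length = k → v ≠ u → secW g v = 1) :
    g ∈ vertexRist (groupG d) u := by
  rw [mem_vertexRist]
  intro w hw
  rcases le_or_gt k w.length with hk | hk
  · have hl : (w.take k).length = k := by simp [hk]
    conv_lhs => rw [← List.take_append_drop k w]
    rw [smul_append, (mem_levelStab _).1 hg _ hl,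
      h _ hl fun h => hw (h ▸ List.take_prefix k w), one_smul, List.take_append_drop]
  · exact (mem_levelStab _).1 (levelStab_antitone _ hk.le hg) w rfl

variable [hd : Fact (3 ≤ d)]

/-! ### Exponent sums along the levels -/

/-- By `sum_expSum_sec`, each level climbed towards the root costs one factor 2. -/
theorem pow_dvd_expSum_sub {k m : ℕ} {g h : groupG d} (H : ∀ v : Vertex d, v.length = k →
    (2 : ℤ) ^ (k + m) ∣ expSum (secW g v) - expSum (secW h v)) :
    (2 : ℤ) ^ m ∣ expSum g - expSum h := by
  induction k generalizing g h m with
  | zero => simpa using H [] rfl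
  | succ k ih =>
    have h1 : ∀ x, (2 : ℤ) ^ (m + 1) ∣ expSum (sec g x) - expSum (sec h x) := fun x =>
      ih fun v hv => by
        have := H (x :: v) (by simp [hv])
        rwa [show k + (m + 1) = k + 1 + m by ring]
    have h2 : (2 : ℤ) ^ (m + 1) ∣ 2 * (expSum g - expSum h) := by
      rw [mul_sub, ← sum_expSum_sec, ← sum_expSum_sec, ← Finset.sum_sub_distrib]
      exact Finset.dvd_sum fun x _ => h1 x
    rw [pow_succ, mul_comm] at h2
    exact Int.dvd_of_mul_dvd_mul_left two_ne_zero h2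

/-- The sections of `g` at a level `k` can be replaced by any others whose exponent sums are the
same modulo `2 ^ (k + 1)`. -/
theorem exists_secW_eq (hodd : Odd d) (k : ℕ) (g : groupG d) (h : Vertex d → groupG d)
    (H : ∀ v : Vertex d, v.length = k →
      (2 : ℤ) ^ (k + 1) ∣ expSum (h v) - expSum (secW g v)) :
    ∃ g' : groupG d, ∀ v : Vertex d, v.length = k → g' • v = g • v ∧ secW g' v = h v := by
  induction k generalizing g h with
  | zero =>
    refine ⟨h [], fun v hv => ?_⟩
    rw [List.eq_nil_of_length_eq_zero hv, smul_nil, smul_nil]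
    exact ⟨rfl, rfl⟩
  | succ k ih =>
    choose f hf using fun x => ih (sec g x) (fun v => h (x :: v)) fun v hv =>
      (pow_dvd_pow 2 (Nat.le_succ _)).trans (H (x :: v) (by simp [hv]))
    -- Climbing `k` levels from a congruence modulo `2 ^ (k + 2)` leaves one modulo 4, exactly what
    -- `placed` requires.
    have h1 : ∀ x, (sec g x)⁻¹ * f x ∈ placed x := fun x => by
      rw [mem_placed_iff hodd, expSum_mul, expSum_inv, neg_add_eq_sub]
      exact pow_dvd_expSum_sub (k := k) (m := 2) fun v hv => by
        rw [(hf x v hv).2]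
        exact H (x :: v) (by simp [hv])
    obtain ⟨g', g1, g2⟩ := exists_sec_eq g f h1
    refine ⟨g', fun v hv => ?_⟩
    obtain ⟨x, v, rfl⟩ := List.exists_cons_of_length_eq_add_one hv
    have hv' : v.length = k := by simpa using hv
    rw [smul_cons, smul_cons, g1, g2, (hf x v hv').1, secW_cons, g2, (hf x v hv').2]
    exact ⟨rfl, rfl⟩

theorem even_expSum_secW {k : ℕ} {g : groupG d} (hg : g ∈ levelStab (groupG d) (k + 1))
    {v : Vertex d} (hv : v.length = k) : Even (expSum (secW g v)) :=
  even_expSum (mem_levelStab_one_iff.1 ((mem_levelStab_succ_iff.1 hg).2 v hv))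

theorem expSum_secW_of_mem_vertexRist {g : groupG d} {u : Vertex d}
    (hg : g ∈ vertexRist (groupG d) u) : expSum (secW g u) = 2 ^ u.length * expSum g := by
  induction u generalizing g with
  | nil => simp
  | cons x u ih =>
    obtain ⟨h1, h2⟩ := sec_of_mem_vertexRist_cons hg
    have h3 := sum_expSum_sec g
    rw [Finset.sum_eq_single x (fun y _ hy => by rw [h1 y hy, expSum_one]) (by simp)] at h3
    rw [secW_cons, ih h2, h3, List.length_cons]
    ring

/-- Description of the rigid stabilizers of the levels by exponent sums of sections. -/
theorem mem_levelRist_succ_iff (hodd : Odd d) {k : ℕ} {g : groupG d} :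
    g ∈ levelRist (groupG d) (k + 1) ↔ g ∈ levelStab (groupG d) (k + 1) ∧
      ∀ v : Vertex d, v.length = k + 1 → (2 : ℤ) ^ (k + 2) ∣ expSum (secW g v) := by
  constructor
  · intro hg
    refine ⟨levelRist_le_levelStab _ _ hg, ?_⟩
    induction hg using Subgroup.iSup_induction' with
    | hp u g hg =>
      intro v hv
      by_cases hvu : v = u
      · subst hvu
        have hg' : g ∈ levelStab (groupG d) 1 := levelStab_antitone _ (Nat.le_add_left 1 k)
          (levelRist_le_levelStab _ _ ((le_iSup (fun v : {v : Vertex d // v.length = k + 1} =>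
            vertexRist (groupG d) v.1) u) hg))
        -- The section at `u` contributes `2 ^ (k + 1)`; the last factor 2 comes from the parity of
        -- `expSum g`, as `g` fixes the first level.
        rw [expSum_secW_of_mem_vertexRist hg, hv, pow_succ]
        exact mul_dvd_mul_left _ (even_iff_two_dvd.1 (even_expSum (mem_levelStab_one_iff.1 hg')))
      · rw [secW_of_mem_vertexRist hg (hv.trans u.2.symm) hvu, expSum_one]
        exact dvd_zero _
    | h1 => intro v _; rw [secW_one, expSum_one]; exact dvd_zero _
    | hmul g h hg hh ihg ihh =>
      intro v hv
      rw [secW_mul_of_mem g (levelRist_le_levelStab _ _ hh) hv, expSum_mul]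
      exact dvd_add (ihg v hv) (ihh v hv)
  · rintro ⟨hg, h⟩
    -- Each section of `g` at level `k + 1` can be isolated by `exists_secW_eq` applied to the
    -- identity, giving an element of one rigid stabilizer; `g` is the product of these.
    have key : ∀ S : Finset (Vertex d), ∃ p ∈ levelRist (groupG d) (k + 1),
        ∀ v : Vertex d, v.length = k + 1 → secW p v = if v ∈ S then secW g v else 1 := by
      intro S
      induction S using Finset.induction_on with
      | empty => exact ⟨1, one_mem _, fun v _ => by simp [secW_one]⟩
      | insert u S hu ih =>
        obtain ⟨p, p1, p2⟩ := ih
        obtain ⟨q, hq⟩ := exists_secW_eq hodd (k + 1) 1 (fun v => if v = u then secW g u else 1)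
          fun v hv => by
            by_cases hvu : v = u
            · subst hvu; simpa [secW_one] using h v hv
            · simp [hvu, secW_one]
        have q1 : q ∈ levelStab (groupG d) (k + 1) := (mem_levelStab _).2 fun v hv => by
          rw [(hq v hv).1, one_smul]
        have q2 : q ∈ levelRist (groupG d) (k + 1) := by
          by_cases hul : u.length = k + 1
          · exact (le_iSup (fun v : {v : Vertex d // v.length = k + 1} =>
              vertexRist (groupG d) v.1) ⟨u, hul⟩) (mem_vertexRist_of_secW q1 fun v hv hvu => by
                rw [(hq v hv).2, if_neg hvu])
          · have : q = 1 := ext_secW (k + 1) (fun v hv => (hq v hv).1) fun v hv => by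
              rw [(hq v hv).2, if_neg (by rintro rfl; exact hul hv), secW_one]
            exact this ▸ one_mem _
        refine ⟨p * q, mul_mem p1 q2, fun v hv => ?_⟩
        rw [secW_mul_of_mem p q1 hv, p2 v hv, (hq v hv).2]
        by_cases hvu : v = u
        · subst hvu; simp [hu]
        · simp [hvu]
    obtain ⟨p, p1, p2⟩ := key (List.finite_length_eq (ZMod d) (k + 1)).toFinset
    have : g = p := ext_secW (k + 1)
      (fun v hv => by
        rw [(mem_levelStab _).1 hg v hv,
          (mem_levelStab _).1 (levelRist_le_levelStab _ _ p1) v hv])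
      fun v hv => by rw [p2 v hv, if_pos (by simpa using hv)]
    exact this ▸ p1

/-- Exponent sums of sections can be changed by multiples of 4, so realization modulo 4 suffices.
The square of `gen k` realizes the value 2 at `k` and `k + 1`; these vectors generate, modulo 4, all
vectors `2 * n` for which `n` has even sum. -/
theorem exists_expSum_sec_eq (hodd : Odd d) (n : ZMod d → ℤ) (hn : Even (∑ x, n x)) :
    ∃ h ∈ levelStab (groupG d) 1, (∀ x, expSum (sec h x) = 2 * n x) ∧ expSum h = ∑ x, n x := by
  let S : AddSubgroup (ZMod d → ℤ) :=
    { carrier := {m | ∃ h ∈ levelStab (groupG d) 1, ∀ x, (4 : ℤ) ∣ expSum (sec h x) - m x}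
      zero_mem' := ⟨1, one_mem _, fun x => by simp⟩
      add_mem' := by
        rintro m n ⟨g, g1, g2⟩ ⟨h, h1, h2⟩
        refine ⟨g * h, mul_mem g1 h1, fun x => ?_⟩
        rw [sec_mul, mem_levelStab_one_iff.1 h1, expSum_mul, Pi.add_apply, add_sub_add_comm]
        exact dvd_add (g2 x) (h2 x)
      neg_mem' := by
        rintro m ⟨g, g1, g2⟩
        refine ⟨g⁻¹, inv_mem g1, fun x => ?_⟩
        rw [sec_inv, mem_levelStab_one_iff.1 (inv_mem g1), expSum_inv, Pi.neg_apply,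
          neg_sub_neg, ← neg_sub]
        exact (g2 x).neg_right }
  have h4 : ∀ m : ZMod d → ℤ, (∀ x, 4 ∣ m x) → m ∈ S := fun m hm =>
    ⟨1, one_mem _, fun x => by simpa using hm x⟩
  have hpair : ∀ k : ℕ, (Pi.single 0 2 + Pi.single (k : ZMod d) 2 : ZMod d → ℤ) ∈ S := by
    intro k
    induction k with
    | zero =>
      refine h4 _ fun x => ?_
      by_cases hx : x = 0 <;> simp [hx]
    | succ k ih =>
      have h1 := add_one_ne (k : ZMod d)
      have : (Pi.single (k : ZMod d) 2 + Pi.single ((k : ZMod d) + 1) 2 : ZMod d → ℤ) ∈ S := by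
        refine ⟨gen (k : ZMod d) * gen (k : ZMod d), mem_levelStab_one_iff.2 fun x => ?_,
          fun x => ?_⟩
        · rw [← letterPerm_apply, map_mul, letterPerm_gen, Equiv.swap_mul_self]
          rfl
        · obtain rfl | rfl | ⟨hx, hx'⟩ : x = k ∨ x = (k : ZMod d) + 1 ∨
            x ≠ k ∧ x ≠ (k : ZMod d) + 1 := by tauto
          all_goals simp [*, h1.symm, sec_gen, letter_gen]
      have h2 := S.sub_mem (S.add_mem ih this)
        (h4 (Pi.single (k : ZMod d) 4) fun x => by by_cases hx : x = k <;> simp [hx])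
      convert h2 using 1
      push_cast
      have : (Pi.single (k : ZMod d) 4 : ZMod d → ℤ) =
          Pi.single (k : ZMod d) 2 + Pi.single (k : ZMod d) 2 := by
        rw [← Pi.single_add]; norm_num
      rw [this]
      abel
  have hmem : (fun x => 2 * n x) ∈ S := by
    obtain ⟨r, hr⟩ := hn
    have h1 : ∑ x, n x • (Pi.single 0 2 + Pi.single x 2 : ZMod d → ℤ) ∈ S :=
      S.sum_mem fun x _ => S.zsmul_mem (by simpa using hpair x.val) _
    -- The combination `h1` has the surplus `2 * ∑ x, n x = 4 * r` at the letter 0.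
    have h2 := S.sub_mem h1 (h4 (Pi.single 0 (4 * r)) fun x => by by_cases hx : x = 0 <;> simp [hx])
    convert h2 using 1
    ext y
    simp only [smul_add, Finset.sum_add_distrib, Pi.sub_apply, Pi.add_apply, Finset.sum_apply,
      Pi.smul_apply, smul_eq_mul]
    rw [← Finset.sum_mul, hr, Finset.sum_eq_single y (fun x _ hx => by simp [hx.symm])
      (by simp)]
    by_cases hy : y = 0
    · subst hy; simp; ring
    · simp [hy]; ring
  obtain ⟨f, f1, f2⟩ := hmem
  obtain ⟨h, h1, h2⟩ := exists_sec_eq f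
    (fun x => sec f x * gen 0 ^ (2 * n x - expSum (sec f x))) fun x => by
      rw [inv_mul_cancel_left, mem_placed_iff hodd, expSum_zpow, expSum_gen, mul_one, ← neg_sub]
      exact (f2 x).neg_right
  have h3 : ∀ x, expSum (sec h x) = 2 * n x := fun x => by
    rw [h2, expSum_mul, expSum_zpow, expSum_gen]
    ring
  refine ⟨h, mem_levelStab_one_iff.2 fun x => by rw [h1, mem_levelStab_one_iff.1 f1], h3, ?_⟩
  have h4 := sum_expSum_sec h
  simp only [h3, ← Finset.mul_sum] at h4
  omega

/-- Every compatible family of exponent sums is realized at all levels. -/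
theorem exists_mem_levelStab_expSum_secW (hodd : Odd d) (n : Vertex d → ℤ)
    (hn : ∀ v : Vertex d, ∑ x, n (v ++ [x]) = 2 * n v) (k : ℕ) :
    ∃ g ∈ levelStab (groupG d) k, ∀ v : Vertex d, v.length = k →
      expSum (secW g v) = 2 * n v := by
  induction k with
  | zero =>
    refine ⟨gen 0 ^ (2 * n []), (mem_levelStab _).2 fun u hu => ?_, fun v hv => ?_⟩
    · rw [List.eq_nil_of_length_eq_zero hu, smul_nil]
    · rw [List.eq_nil_of_length_eq_zero hv, secW_nil, expSum_zpow, expSum_gen, mul_one]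
  | succ k ih =>
    obtain ⟨g, g1, g2⟩ := ih
    choose h h1 h2 h3 using fun v : Vertex d =>
      exists_expSum_sec_eq hodd (fun x => n (v ++ [x])) ⟨n v, by rw [hn]; ring⟩
    -- The new section `h v` has exponent sum `∑ x, n (v ++ [x]) = 2 * n v`, the same as the section
    -- of `g` that it replaces.
    obtain ⟨g', hg'⟩ := exists_secW_eq hodd k g h fun v hv => by
      rw [h3, hn, g2 v hv, sub_self]
      exact dvd_zero _
    refine ⟨g', mem_levelStab_succ_iff.2 ⟨(mem_levelStab _).2 fun v hv => ?_, fun v hv => ?_⟩,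
      fun v hv => ?_⟩
    · rw [(hg' v hv).1, (mem_levelStab _).1 g1 v hv]
    · rw [(hg' v hv).2]
      exact h1 v
    · obtain ⟨u, x, hu, rfl⟩ := exists_eq_append_singleton hv
      rw [secW_append, (hg' u hu).2, secW_cons, secW_nil, h2]

theorem expSum_secW_of_le {n : Vertex d → ℤ} (hn : ∀ v : Vertex d, ∑ x, n (v ++ [x]) = 2 * n v)
    {k : ℕ} {g : groupG d} (H : ∀ v : Vertex d, v.length = k → expSum (secW g v) = 2 * n v)
    {v : Vertex d} (hv : v.length ≤ k) : expSum (secW g v) = 2 * n v := by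
  induction k with
  | zero => exact H v (by omega)
  | succ k ih =>
    rcases hv.lt_or_eq with h | h
    · refine ih (fun v hv => ?_) (by omega)
      have h1 := sum_expSum_sec (secW g v)
      have h2 : ∀ x, expSum (sec (secW g v) x) = 2 * n (v ++ [x]) := fun x => by
        rw [← H (v ++ [x]) (by simp [hv]), secW_append, secW_cons, secW_nil]
      simp only [h2, ← Finset.mul_sum, hn] at h1
      omega
    · exact H v h

theorem not_congruenceSubgroupProperty (hodd : Odd d) :
    ¬ CongruenceSubgroupProperty (groupG d) := by
  intro h
  let f : groupG d →* Multiplicative (ZMod 4) :=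
    { toFun := fun g => Multiplicative.ofAdd ((expSum g : ℤ) : ZMod 4)
      map_one' := by simp
      map_mul' := fun g h => by simp }
  obtain ⟨k, hk⟩ := h f.ker inferInstance
  -- This compatible family lives on the ray of zeros and has value 1 at the root, so it produces
  -- elements of St(k) with exponent sum 2, which is nonzero modulo 4.
  let n : Vertex d → ℤ := fun v => if ∀ x ∈ v, x = 0 then 2 ^ v.length else 0
  have hn : ∀ v : Vertex d, ∑ x, n (v ++ [x]) = 2 * n v := fun v => by
    rw [Finset.sum_eq_single 0 (fun x _ hx => by simp [n, hx]) (by simp)]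
    have h0 : (∀ y ∈ v ++ [0], y = 0) ↔ ∀ y ∈ v, y = 0 := by simp [or_imp]
    simp only [n]
    by_cases hv : ∀ y ∈ v, y = 0
    · rw [if_pos (h0.2 hv), if_pos hv, List.length_append, List.length_singleton, pow_succ, mul_comm]
    · rw [if_neg (mt h0.1 hv), if_neg hv, mul_zero]
  obtain ⟨g, g1, g2⟩ := exists_mem_levelStab_expSum_secW hodd n hn k
  have h3 : ((expSum g : ℤ) : ZMod 4) = 0 := Multiplicative.ofAdd.injective (hk g1)
  rw [← secW_nil g, expSum_secW_of_le hn g2 (by simp)] at h3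
  simp only [n, List.not_mem_nil, false_imp_iff, implies_true, if_true, List.length_nil,
    pow_zero] at h3
  exact absurd h3 (by decide)

end GroupG

/-! ### The rigid kernel as an inverse limit -/

section RigidKernel

variable {d : ℕ} (G : Subgroup (TreeAut d))

theorem stabModRistIncl_injective (k : ℕ) : Function.Injective (stabModRistIncl G k) := by
  rw [injective_iff_map_eq_one]
  intro q hq
  obtain ⟨g, rfl⟩ := QuotientGroup.mk_surjective q
  exact (QuotientGroup.eq_one_iff g).2 ((QuotientGroup.eq_one_iff (g : G)).1 hq)

theorem ristToStab_stabModRistIncl {k : ℕ} (q : StabModRist G k) :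
    ristToStab G k (stabModRistIncl G k q) = 1 := by
  obtain ⟨g, rfl⟩ := QuotientGroup.mk_surjective q
  exact (QuotientGroup.eq_one_iff (g : G)).2 g.2

theorem exists_stabModRistIncl_eq {k : ℕ} {q : G ⧸ levelRist G k} (hq : ristToStab G k q = 1) :
    ∃ p, stabModRistIncl G k p = q := by
  obtain ⟨g, rfl⟩ := QuotientGroup.mk_surjective q
  exact ⟨((⟨g, (QuotientGroup.eq_one_iff g).1 hq⟩ : levelStab G k) : StabModRist G k), rfl⟩

theorem quotientProj_stabModRistIncl {k l : ℕ} (h : k ≤ l) (q : StabModRist G l) :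
    quotientProj (levelRist_antitone G h) (stabModRistIncl G l q) =
      stabModRistIncl G k (stabModRistMap G h q) := by
  obtain ⟨g, rfl⟩ := QuotientGroup.mk_surjective q
  rfl

/-- The homomorphism from the inverse limit of the groups `St(k) / Rist(k)` to the rigid kernel
induced by the inclusions `St(k) ≤ G`. -/
def stabModRistLimitToRigidKernel : stabModRistLimit G →* rigidKernel G where
  toFun x := ⟨⟨fun k => stabModRistIncl G (k + 1) (x.1 k), fun k l h => by
      rw [quotientProj_stabModRistIncl G (Nat.succ_le_succ h)]
      exact congrArg _ (x.2 k l h)⟩,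
    Subtype.ext (funext fun k => ristToStab_stabModRistIncl G (x.1 k))⟩
  map_one' := Subtype.ext (Subtype.ext (funext fun _ => map_one _))
  map_mul' _ _ := Subtype.ext (Subtype.ext (funext fun _ => map_mul _ _ _))

/-- At each level the kernel of G/Rist(k) → G/St(k) is St(k)/Rist(k). Preimages chosen level by
level are automatically compatible because the inclusions are injective. -/
theorem stabModRistLimitToRigidKernel_bijective :
    Function.Bijective (stabModRistLimitToRigidKernel G) := by
  constructor
  · intro x y h
    refine Subtype.ext (funext fun k => stabModRistIncl_injective G (k + 1) ?_)
    exact congrArg (fun z : rigidKernel G => z.1.1 k) h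
  · rintro ⟨y, hy⟩
    choose x hx using fun k => exists_stabModRistIncl_eq G (k := k + 1) (q := y.1 k)
      (congrFun (congrArg Subtype.val hy) k)
    refine ⟨⟨x, fun k l h => stabModRistIncl_injective G (k + 1) ?_⟩,
      Subtype.ext (Subtype.ext (funext hx))⟩
    rw [← quotientProj_stabModRistIncl G (Nat.succ_le_succ h), hx, hx]
    exact y.2 k l h

end RigidKernel

/-! ### The inverse limit of the groups `St(k) / Rist(k)` of `G_d` -/

namespace GroupG

variable {d : ℕ}

/-- A family of integers on the vertices with given values at the vertices not ending in `0`, such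
that the sum over the children of a vertex is twice the value at the vertex. -/
theorem exists_compatible_family [NeZero d] (β : Vertex d → {x : ZMod d // x ≠ 0} → ℤ) :
    ∃ n : Vertex d → ℤ, (∀ v x, n (v ++ [x.1]) = β v x) ∧
      ∀ v : Vertex d, ∑ x, n (v ++ [x]) = 2 * n v := by
  -- The recursion strips the last letter, so `m` takes reversed words. The value 0 at the root is a
  -- free choice, as the root coordinate only counts modulo `2 ^ 0`.
  let m : Vertex d → ℤ := fun v => List.rec (motive := fun _ => ℤ) 0
    (fun x v r => if h : x ≠ 0 then β v.reverse ⟨x, h⟩ else 2 * r - ∑ y, β v.reverse y) v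
  have m1 : ∀ (v : Vertex d) (x : {x : ZMod d // x ≠ 0}), m (x.1 :: v) = β v.reverse x :=
    fun v x => dif_pos x.2
  have m2 : ∀ v : Vertex d, m (0 :: v) = 2 * m v - ∑ y, β v.reverse y :=
    fun v => dif_neg (not_not.2 rfl)
  refine ⟨fun v => m v.reverse, fun v x => ?_, fun v => ?_⟩
  · change m (v ++ [x.1]).reverse = _
    rw [List.reverse_append, List.reverse_singleton, List.singleton_append, m1,
      List.reverse_reverse]
  · simp only [List.reverse_append, List.reverse_singleton, List.singleton_append]
    rw [← Fintype.sum_subtype_add_sum_subtype (fun x : ZMod d => x ≠ 0)]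
    have h0 : ∀ x : {x : ZMod d // ¬ x ≠ 0}, x.1 = 0 := fun x => not_not.1 x.2
    have h1 : ∑ x : {x : ZMod d // ¬ x ≠ 0}, m (x.1 :: v.reverse) = m (0 :: v.reverse) := by
      rw [Fintype.sum_eq_single ⟨0, not_not.2 rfl⟩ fun x hx => absurd (Subtype.ext (h0 x)) hx]
    rw [h1, m2]
    simp only [m1]
    ring

theorem mul_inv_mem_levelRist_of_limit (x : stabModRistLimit (groupG d))
    {g : ∀ k, levelStab (groupG d) (k + 1)}
    (hg : ∀ k, ((g k : levelStab (groupG d) (k + 1)) : StabModRist (groupG d) (k + 1)) = x.1 k)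
    (k : ℕ) : (g k : groupG d)⁻¹ * (g (k + 1) : groupG d) ∈ levelRist (groupG d) (k + 1) := by
  have h := x.2 k (k + 1) (Nat.le_succ k)
  rw [← hg, ← hg] at h
  have h' : ((g k : levelStab (groupG d) (k + 1)) : StabModRist (groupG d) (k + 1)) =
    (Subgroup.inclusion (levelStab_antitone (groupG d) (Nat.le_succ (k + 1))) (g (k + 1)) :
      levelStab (groupG d) (k + 1)) := h.symm
  have h2 := QuotientGroup.eq.1 h'
  exact h2

variable [hd : Fact (3 ≤ d)]

/-- This makes the halved exponent sums at level `k` well defined modulo `2 ^ k` on St(k + 1)/Rist(k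
+ 1). -/
theorem pow_dvd_expSum_secW_of_mem_levelRist (hodd : Odd d) {k : ℕ} {g : groupG d}
    (hg : g ∈ levelRist (groupG d) (k + 1)) {v : Vertex d} (hv : v.length = k) :
    (2 : ℤ) ^ (k + 1) ∣ expSum (secW g v) := by
  have h := pow_dvd_expSum_sub (k := 1) (m := k + 1) (g := secW g v) (h := 1) fun u hu => by
    rw [← secW_append, secW_one, expSum_one, sub_zero, show 1 + (k + 1) = k + 2 by ring]
    exact ((mem_levelRist_succ_iff hodd).1 hg).2 _ (by simp [hv, hu])
  simpa using h

/-- Half of the exponent sums of the sections at the level `k`, on `St(k + 1) / Rist(k + 1)`. -/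
noncomputable def halfExpSum (hodd : Odd d) (k : ℕ) :
    StabModRist (groupG d) (k + 1) →*
      Multiplicative ({v : Vertex d // v.length = k} → ZMod (2 ^ k)) :=
  QuotientGroup.lift _
    { toFun := fun g => Multiplicative.ofAdd fun v =>
        ((expSum (secW g.1 v.1) / 2 : ℤ) : ZMod (2 ^ k))
      map_one' := by
        refine congrArg Multiplicative.ofAdd (funext fun v => ?_)
        simp [secW_one]
      map_mul' := fun g h => by
        rw [← ofAdd_add]
        refine congrArg Multiplicative.ofAdd (funext fun v => ?_)
        have h1 := even_iff_two_dvd.1 (even_expSum_secW g.2 v.2)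
        rw [Subgroup.coe_mul,
          secW_mul_of_mem _ (levelStab_antitone _ (Nat.le_succ k) h.2) v.2, expSum_mul,
          Int.add_ediv_of_dvd_left h1, Int.cast_add]
        rfl } fun g hg => by
    refine congrArg Multiplicative.ofAdd (funext fun v => ?_)
    have h := pow_dvd_expSum_secW_of_mem_levelRist hodd hg v.2
    rw [pow_succ] at h
    have h2 := Int.dvd_div_of_mul_dvd (mul_comm ((2 : ℤ) ^ k) 2 ▸ h)
    refine (ZMod.intCast_zmod_eq_zero_iff_dvd _ _).2 ?_
    exact_mod_cast h2

theorem halfExpSum_mk (hodd : Odd d) (k : ℕ) (g : levelStab (groupG d) (k + 1))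
    (v : {v : Vertex d // v.length = k}) :
    (halfExpSum hodd k (g : StabModRist (groupG d) (k + 1))).toAdd v =
      ((expSum (secW g.1 v.1) / 2 : ℤ) : ZMod (2 ^ k)) := rfl

/-- The vertices of level `k + 1` whose last letter is not `0`. -/
abbrev FreeVertex (d k : ℕ) : Type := {v : Vertex d // v.length = k} × {x : ZMod d // x ≠ 0}

/-- The coordinates at the vertices not ending in `0` on the inverse limit of the groups
`St(k) / Rist(k)`. -/
noncomputable def limitCoord (hodd : Odd d) :
    stabModRistLimit (groupG d) →*
      Multiplicative (∀ k : ℕ, FreeVertex d k → ZMod (2 ^ (k + 1))) where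
  toFun x := Multiplicative.ofAdd fun k p =>
    (halfExpSum hodd (k + 1) (x.1 (k + 1))).toAdd ⟨p.1.1 ++ [p.2.1], by simp [p.1.2]⟩
  map_one' := by
    refine congrArg Multiplicative.ofAdd (funext fun k => funext fun p => ?_)
    simp
  map_mul' x y := by
    rw [← ofAdd_add]
    refine congrArg Multiplicative.ofAdd (funext fun k => funext fun p => ?_)
    simp

theorem limitCoord_injective (hodd : Odd d) : Function.Injective (limitCoord (d := d) hodd) := by
  rw [injective_iff_map_eq_one]
  intro x hx
  choose g hg using fun k => QuotientGroup.mk_surjective (x.1 k)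
  have hrist := mul_inv_mem_levelRist_of_limit x hg
  -- Induction on the level: divisibility at `v` doubles to divisibility of the sum over its
  -- children, and the vanishing coordinates handle all children except `v ++ [0]`, which follows by
  -- subtraction.
  have key : ∀ (k : ℕ) (v : Vertex d), v.length = k →
      (2 : ℤ) ^ (k + 1) ∣ expSum (secW (g k : groupG d) v) := by
    intro k
    induction k with
    | zero =>
      intro v hv
      simpa using even_iff_two_dvd.1 (even_expSum_secW (g 0).2 hv)
    | succ k ih =>
      intro u hu
      have h0 : ∀ v : Vertex d, v.length = k →
          (2 : ℤ) ^ (k + 1) ∣ expSum (secW (g (k + 1) : groupG d) v) := fun v hv => by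
        have h1 := pow_dvd_expSum_secW_of_mem_levelRist hodd (hrist k) hv
        have h2 : (g (k + 1) : groupG d) = g k * ((g k : groupG d)⁻¹ * g (k + 1)) := by group
        rw [h2, secW_mul_of_mem _ (levelStab_antitone _ (Nat.le_succ k)
          (levelRist_le_levelStab _ _ (hrist k))) hv, expSum_mul]
        exact dvd_add (ih v hv) h1
      have h1 : ∀ v : Vertex d, v.length = k → ∀ x, x ≠ 0 →
          (2 : ℤ) ^ (k + 2) ∣ expSum (secW (g (k + 1) : groupG d) (v ++ [x])) := fun v hv y hy => by
        have h2 : (((expSum (secW (g (k + 1) : groupG d) (v ++ [y])) / 2 : ℤ)) :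
            ZMod (2 ^ (k + 1))) = 0 := by
          have h3 := congrFun (congrFun (congrArg Multiplicative.toAdd hx) k) (⟨v, hv⟩, ⟨y, hy⟩)
          change (halfExpSum hodd (k + 1) (x.1 (k + 1))).toAdd ⟨v ++ [y], by simp [hv]⟩ = 0 at h3
          rwa [← hg, halfExpSum_mk] at h3
        rw [ZMod.intCast_zmod_eq_zero_iff_dvd] at h2
        push_cast at h2
        obtain ⟨r, hr⟩ := even_iff_two_dvd.1
          (even_expSum_secW (g (k + 1)).2 (v := v ++ [y]) (by simp [hv]))
        rw [hr, Int.mul_ediv_cancel_left _ two_ne_zero] at h2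
        rw [hr, pow_succ, mul_comm]
        exact mul_dvd_mul_left 2 h2
      obtain ⟨v, y, hv, rfl⟩ := exists_eq_append_singleton hu
      by_cases hy : y = 0
      · have h2 := sum_expSum_sec (secW (g (k + 1) : groupG d) v)
        rw [← Finset.add_sum_erase _ _ (Finset.mem_univ (0 : ZMod d))] at h2
        have h3 := mul_dvd_mul_left 2 (h0 v hv)
        rw [← pow_succ', ← h2] at h3
        have h4 : (2 : ℤ) ^ (k + 2) ∣ ∑ y ∈ Finset.univ.erase (0 : ZMod d),
            expSum (sec (secW (g (k + 1) : groupG d) v) y) := Finset.dvd_sum fun y hy => by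
          have := h1 v hv y (Finset.ne_of_mem_erase hy)
          rwa [secW_append] at this
        rw [hy, secW_append]
        exact (dvd_add_left h4).1 h3
      · exact h1 v hv y hy
  refine Subtype.ext (funext fun k => ?_)
  -- The bound for `g k` concerns level `k`, one short of what Rist(k + 1) needs; so the next
  -- representative `g (k + 1)`, congruent to `g k` modulo Rist(k + 1), is used instead.
  have h1 : (g (k + 1) : groupG d) ∈ levelRist (groupG d) (k + 1) :=
    (mem_levelRist_succ_iff hodd).2
      ⟨levelStab_antitone _ (Nat.le_succ _) (g (k + 1)).2, key (k + 1)⟩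
  have h2 := mul_mem h1 (inv_mem (hrist k))
  rw [mul_inv_rev, inv_inv, mul_inv_cancel_left] at h2
  rw [← hg]
  exact (QuotientGroup.eq_one_iff _).2 h2

theorem limitCoord_surjective (hodd : Odd d) :
    Function.Surjective (limitCoord (d := d) hodd) := by
  intro b
  obtain ⟨n, n1, n2⟩ := exists_compatible_family (d := d)
    fun v x => ((b.toAdd v.length (⟨v, rfl⟩, x)).val : ℤ)
  choose g g1 g2 using exists_mem_levelStab_expSum_secW hodd n n2
  refine ⟨⟨fun k => ((⟨g (k + 1), g1 (k + 1)⟩ : levelStab (groupG d) (k + 1)) :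
    StabModRist (groupG d) (k + 1)), fun k l h => ?_⟩, ?_⟩
  · refine QuotientGroup.eq.2 ?_
    have h1 := levelStab_antitone (groupG d) (Nat.succ_le_succ h) (g1 (l + 1))
    change (g (l + 1))⁻¹ * g (k + 1) ∈ levelRist (groupG d) (k + 1)
    -- Both representatives realize the same integer family, so the exponent sums of the sections of
    -- their quotient at level `k + 1` are exactly zero.
    refine (mem_levelRist_succ_iff hodd).2 ⟨mul_mem (inv_mem h1) (g1 _), fun v hv => ?_⟩
    rw [secW_mul_of_mem _ (g1 _) hv, secW_inv_of_mem h1 hv, expSum_mul, expSum_inv,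
      g2 _ v hv, expSum_secW_of_le n2 (g2 (l + 1)) (by omega), neg_add_cancel]
    exact dvd_zero _
  · refine congrArg Multiplicative.ofAdd (funext fun k => funext fun p => ?_)
    obtain ⟨⟨v, rfl⟩, y⟩ := p
    rw [halfExpSum_mk]
    rw [expSum_secW_of_le n2 (g2 _) (by simp), Int.mul_ediv_cancel_left _ two_ne_zero, n1, Int.cast_natCast,
      ZMod.natCast_zmod_val]
    rfl

theorem nonempty_freeVertex_equiv_fin (k : ℕ) :
    Nonempty (FreeVertex d k ≃ Fin (d ^ (k + 1) - d ^ k)) := by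
  have : Fintype {v : Vertex d // v.length = k} :=
    inferInstanceAs (Fintype (List.Vector (ZMod d) k))
  refine ⟨Fintype.equivFinOfCardEq ?_⟩
  have h : Fintype.card {v : Vertex d // v.length = k} = d ^ k := by
    have h1 := card_vector (α := ZMod d) k
    rw [ZMod.card] at h1
    rw [← h1]
    exact Fintype.card_congr (Equiv.refl _)
  rw [Fintype.card_prod, h, Fintype.card_subtype_compl, Fintype.card_subtype_eq, ZMod.card,
    pow_succ, Nat.mul_sub, mul_one]

theorem nonempty_stabModRistLimit_mulEquiv (hodd : Odd d) :
    Nonempty (stabModRistLimit (groupG d) ≃*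
      Multiplicative (∀ k : ℕ, Fin (d ^ (k + 1) - d ^ k) → ZMod (2 ^ (k + 1)))) := by
  have e := fun k => (nonempty_freeVertex_equiv_fin (d := d) k).some
  exact ⟨(MulEquiv.ofBijective (limitCoord hodd)
    ⟨limitCoord_injective hodd, limitCoord_surjective hodd⟩).trans
    (AddEquiv.toMultiplicative (AddEquiv.piCongrRight fun k =>
      AddEquiv.arrowCongr (e k) (AddEquiv.refl _)))⟩

end GroupG

/-- For odd `d ≥ 3`: the rigid kernel of `G_d` is, canonically, the inverse limit of the groups
`St(k) / Rist(k)`, `k ≥ 1`; it is isomorphic to the product over `k ≥ 1` of the groups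
`(ℤ/2^k)^(d^k - d^(k-1))`; and `G_d` does not have the congruence subgroup property. -/
theorem theorem5 (d : ℕ) (hd : 3 ≤ d) (hodd : Odd d) :
    (∃ e : stabModRistLimit (groupG d) ≃* rigidKernel (groupG d),
      ∀ (x : stabModRistLimit (groupG d)) (k : ℕ),
        (e x).1.1 k = stabModRistIncl (groupG d) (k + 1) (x.1 k)) ∧
    Nonempty (rigidKernel (groupG d) ≃*
      Multiplicative (∀ k : ℕ, Fin (d ^ (k + 1) - d ^ k) → ZMod (2 ^ (k + 1)))) ∧
    ¬ CongruenceSubgroupProperty (groupG d) := by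
  have : Fact (3 ≤ d) := ⟨hd⟩
  let e := MulEquiv.ofBijective (stabModRistLimitToRigidKernel (groupG d))
    (stabModRistLimitToRigidKernel_bijective (groupG d))
  obtain ⟨f⟩ := GroupG.nonempty_stabModRistLimit_mulEquiv (d := d) hodd
  exact ⟨⟨e, fun _ _ => rfl⟩, ⟨e.symm.trans f⟩, GroupG.not_congruenceSubgroupProperty hodd⟩
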